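/- Let $\mathbb{K}$ be a field, let $Q$ be a finite connected quiver, let $J$ be the two-sided ideal of the path algebra $\mathbb{K}Q$ generated by the arrows, and let $A$ be a finite-dimensional $\mathbb{K}$-algebra isomorphic to $\mathbb{K}Q/J^2$ (a radical square zero algebra). Then $$\phi\dim(A)=\phi\dim(A^{op}).$$ Here, for a finite-dimensional algebra $B$, $K_0(B)$ is the abelian group generated by the symbols $[M]$, one for each isomorphism class of finitely generated right $B$-modules, with relations $[M]=[M']+[M'']$ whenever $M\cong M'\oplus M''$ and $[P]=0$ for $P$ projective. Let $\overline{\Omega}\colon K_0(B)\to K_0(B)$ be the endomorphism with $\overline{\Omega}[M]=[\Omega M]$, where $\Omega M$ is the kernel of a projective cover of $M$, and let $\langle \mathrm{add}\,M\rangle\subseteq K_0(B)$ be the subgroup generated by the classes of the indecomposable direct summands of $M$. The (right) Igusa-Todorov function is $$\phi(M)=\min\{\,l\in\mathbb{N} : \overline{\Omega}|_{\overline{\Omega}^{\,l+s}\langle \mathrm{add}\,M\rangle}\text{ is injective for all } s\in\mathbb{N}\,\},$$ and $\phi\dim(B)=\sup\{\phi(M) : M \text{ a finitely generated right } B\text{-module}\}\in\mathbb{N}\cup\{\infty\}$.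 -/

import Mathlib

universe u v w x

/-! ### The Igusa-Todorov function and the `φ`-dimension of a left Artinian ring

Modules are first left modules over a ring `R`; right `A`-modules are left `Aᵐᵒᵖ`-modules. -/

namespace IgusaTodorov

/-- `f : P → M` is a projective cover: `P` is projective, `f` is onto and its kernel is
superfluous. -/
structure IsProjectiveCover {R : Type*} [Ring R] {P M : Type*} [AddCommGroup P] [Module R P]
    [AddCommGroup M] [Module R M] (f : P →ₗ[R] M) : Prop where
  projective : Module.Projective R P
  surjective : Function.Surjective f
  superfluous : ∀ N : Submodule R P, N ⊔ LinearMap.ker f = ⊤ → N = ⊤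

/-- Finitely generated modules over a left Artinian ring have finitely generated projective
covers: a projective presentation of least length is one. -/
theorem exists_isProjectiveCover {R : Type u} [Ring R] [IsArtinianRing R] (M : Type u)
    [AddCommGroup M] [Module R M] [Module.Finite R M] :
    ∃ (P : FGModuleCat.{u} R) (f : P →ₗ[R] M), IsProjectiveCover f := by
  classical
  let S : Set ℕ∞ := {l | ∃ (P : FGModuleCat.{u} R) (f : P →ₗ[R] M),
    Module.Projective R P ∧ Function.Surjective f ∧ Module.length R P = l}
  have hS : S.Nonempty := by
    obtain ⟨n, f, hf⟩ := Module.Finite.exists_fin' R M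
    exact ⟨_, FGModuleCat.of R (Fin n → R), f, inferInstanceAs (Module.Projective R (Fin n → R)),
      hf, rfl⟩
  obtain ⟨P, f, hP, hf, hl⟩ := csInf_mem hS
  refine ⟨P, f, hP, hf, fun N hN => ?_⟩
  by_contra hne
  have hfN : Function.Surjective (f.comp N.subtype) := by
    intro m
    obtain ⟨p, rfl⟩ := hf m
    have hp : p ∈ N ⊔ LinearMap.ker f := hN ▸ Submodule.mem_top
    obtain ⟨n, hn, k, hk, rfl⟩ := Submodule.mem_sup.1 hp
    refine ⟨⟨n, hn⟩, ?_⟩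
    simp [LinearMap.mem_ker.1 hk]
  obtain ⟨h, hh⟩ := Module.projective_lifting_property _ f hfN
  let g : Module.End R P := N.subtype.comp h
  have hfg : ∀ x, f (g x) = f x := fun x => LinearMap.congr_fun hh x
  have hfgn : ∀ (n : ℕ) (x : P), f ((g ^ n) x) = f x := by
    intro n
    induction n with
    | zero => intro x; simp
    | succ n ih => intro x; rw [pow_succ, Module.End.mul_apply, ih, hfg]
  obtain ⟨n, hn, hn0⟩ := ((LinearMap.eventually_isCompl_ker_pow_range_pow g).and
    (Filter.eventually_gt_atTop 0)).exists
  set U : Submodule R P := LinearMap.range (g ^ n) with hU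
  have hUN : U ≤ N := by
    rintro _ ⟨x, rfl⟩
    obtain ⟨k, rfl⟩ := Nat.exists_eq_succ_of_ne_zero hn0.ne'
    rw [Nat.succ_eq_add_one, pow_succ', Module.End.mul_apply]
    exact (h _).2
  have hproj : Module.Projective R U := by
    refine Module.Projective.of_split U.subtype (U.projectionOnto _ hn.symm) ?_
    ext x
    simp
  have hle : sInf S ≤ Module.length R U := by
    refine csInf_le ⟨0, fun _ _ => zero_le⟩
      ⟨FGModuleCat.of R U, f.comp U.subtype, hproj, ?_, rfl⟩
    intro m
    obtain ⟨p, rfl⟩ := hf m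
    exact ⟨⟨(g ^ n) p, p, rfl⟩, hfgn n p⟩
  have hlt : Module.length R U < Module.length R P :=
    Submodule.length_lt (lt_of_le_of_lt hUN (lt_top_iff_ne_top.2 hne)).ne
  exact absurd hle (not_le.2 (hl ▸ hlt))

section Grothendieck

variable (R : Type u) [Ring R]

/-- The relations `[M] = [M'] + [M'']` for `M ≅ M' ⊕ M''`, and `[P] = 0` for `P` projective.
As the zero module is projective, they identify the symbols of isomorphic modules. -/
def relations : Set (FreeAbelianGroup (FGModuleCat.{u} R)) :=
  {x | ∃ M M' M'' : FGModuleCat.{u} R, Nonempty (M ≃ₗ[R] M' × M'') ∧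
      x = FreeAbelianGroup.of M - FreeAbelianGroup.of M' - FreeAbelianGroup.of M''} ∪
  {x | ∃ P : FGModuleCat.{u} R, Module.Projective R P ∧ x = FreeAbelianGroup.of P}

/-- The group `K₀`: generated by the finitely generated modules, subject to `relations`. -/
abbrev K0 : Type (u + 1) :=
  FreeAbelianGroup (FGModuleCat.{u} R) ⧸ AddSubgroup.closure (relations R)

variable {R}

/-- The class `[M]` in `K₀` of a finitely generated module. -/
def cls (M : Type u) [AddCommGroup M] [Module R M] [Module.Finite R M] : K0 R :=
  QuotientAddGroup.mk (FreeAbelianGroup.of (FGModuleCat.of R M))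

theorem cls_of_projective (P : Type u) [AddCommGroup P] [Module R P] [Module.Finite R P]
    (hP : Module.Projective R P) : (cls P : K0 R) = 0 :=
  (QuotientAddGroup.eq_zero_iff _).2
    (AddSubgroup.subset_closure (Or.inr ⟨FGModuleCat.of R P, hP, rfl⟩))

theorem cls_of_equiv_prod {M M' M'' : Type u} [AddCommGroup M] [Module R M] [Module.Finite R M]
    [AddCommGroup M'] [Module R M'] [Module.Finite R M'] [AddCommGroup M''] [Module R M'']
    [Module.Finite R M''] (e : M ≃ₗ[R] M' × M'') : (cls M : K0 R) = cls M' + cls M'' := by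
  have h : (QuotientAddGroup.mk (FreeAbelianGroup.of (FGModuleCat.of R M) -
      FreeAbelianGroup.of (FGModuleCat.of R M') -
      FreeAbelianGroup.of (FGModuleCat.of R M'')) : K0 R) = 0 :=
    (QuotientAddGroup.eq_zero_iff _).2 (AddSubgroup.subset_closure (Or.inl
      ⟨FGModuleCat.of R M, FGModuleCat.of R M', FGModuleCat.of R M'', ⟨e⟩, rfl⟩))
  rw [QuotientAddGroup.mk_sub, QuotientAddGroup.mk_sub, sub_sub, sub_eq_zero] at h
  exact h

/-- Schanuel's lemma. -/
theorem schanuel {M P Q : Type*} [AddCommGroup M] [Module R M] [AddCommGroup P] [Module R P]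
    [AddCommGroup Q] [Module R Q] (hP : Module.Projective R P) (hQ : Module.Projective R Q)
    (p : P →ₗ[R] M) (q : Q →ₗ[R] M) (hp : Function.Surjective p) (hq : Function.Surjective q) :
    Nonempty ((LinearMap.ker p × Q) ≃ₗ[R] (LinearMap.ker q × P)) := by
  obtain ⟨s, hs⟩ := Module.projective_lifting_property q p hq
  obtain ⟨t, ht⟩ := Module.projective_lifting_property p q hp
  have hs' : ∀ x, q (s x) = p x := LinearMap.congr_fun hs
  have ht' : ∀ x, p (t x) = q x := LinearMap.congr_fun ht
  have hk (x : LinearMap.ker p × Q) : x.2 - s (x.1 + t x.2) ∈ LinearMap.ker q := by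
    have := x.1.2
    rw [LinearMap.mem_ker] at this
    simp [hs', ht', this]
  have hk' (y : LinearMap.ker q × P) : y.2 - t (y.1 + s y.2) ∈ LinearMap.ker p := by
    have := y.1.2
    rw [LinearMap.mem_ker] at this
    simp [hs', ht', this]
  exact ⟨{
    toFun := fun x => (⟨x.2 - s (x.1 + t x.2), hk x⟩, x.1 + t x.2)
    map_add' := fun x y => by ext <;> simp <;> abel
    map_smul' := fun r x => by ext <;> simp [smul_sub]
    invFun := fun y => (⟨y.2 - t (y.1 + s y.2), hk' y⟩, y.1 + s y.2)
    left_inv := fun x => by ext <;> simp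
    right_inv := fun x => by ext <;> simp }⟩

theorem cls_ker_eq [IsNoetherianRing R] {M P Q : Type u} [AddCommGroup M] [Module R M]
    [AddCommGroup P] [Module R P] [Module.Finite R P] [AddCommGroup Q] [Module R Q]
    [Module.Finite R Q] (hP : Module.Projective R P) (hQ : Module.Projective R Q)
    (p : P →ₗ[R] M) (q : Q →ₗ[R] M) (hp : Function.Surjective p) (hq : Function.Surjective q) :
    (cls (LinearMap.ker p) : K0 R) = cls (LinearMap.ker q) := by
  obtain ⟨e⟩ := schanuel hP hQ p q hp hq
  have h1 := cls_of_equiv_prod (LinearEquiv.refl R (LinearMap.ker p × Q))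
  have h2 := cls_of_equiv_prod e
  rw [cls_of_projective P hP] at h2
  rw [cls_of_projective Q hQ] at h1
  simpa using h1.symm.trans h2

end Grothendieck

section Syzygy

variable {R : Type u} [Ring R] [IsArtinianRing R]

/-- The projective cover `P(M)` of a finitely generated module `M`. -/
noncomputable def coverObj (M : FGModuleCat.{u} R) : FGModuleCat.{u} R :=
  (exists_isProjectiveCover (R := R) M).choose

/-- The projective cover map `P(M) → M`. -/
noncomputable def coverMap (M : FGModuleCat.{u} R) : coverObj M →ₗ[R] M :=
  (exists_isProjectiveCover (R := R) M).choose_spec.choose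

theorem coverMap_isProjectiveCover (M : FGModuleCat.{u} R) : IsProjectiveCover (coverMap M) :=
  (exists_isProjectiveCover (R := R) M).choose_spec.choose_spec

/-- The syzygy `Ω(M)`: the kernel of the projective cover of `M`. -/
noncomputable def syzygy (M : FGModuleCat.{u} R) : FGModuleCat.{u} R :=
  FGModuleCat.of R (LinearMap.ker (coverMap M))

theorem cls_syzygy_eq (M : FGModuleCat.{u} R) {P : Type u} [AddCommGroup P] [Module R P]
    [Module.Finite R P] (hP : Module.Projective R P) (p : P →ₗ[R] M)
    (hp : Function.Surjective p) : (cls (syzygy M) : K0 R) = cls (LinearMap.ker p) :=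
  cls_ker_eq (coverMap_isProjectiveCover M).projective hP _ p
    (coverMap_isProjectiveCover M).surjective hp

theorem lift_syzygy_eq_zero (x : FreeAbelianGroup (FGModuleCat.{u} R))
    (hx : x ∈ AddSubgroup.closure (relations R)) :
    FreeAbelianGroup.lift (fun M : FGModuleCat.{u} R => (cls (syzygy M) : K0 R)) x = 0 := by
  rw [← AddMonoidHom.mem_ker]
  refine (AddSubgroup.closure_le _).2 ?_ hx
  rintro _ (⟨M, M', M'', ⟨e⟩, rfl⟩ | ⟨P, hP, rfl⟩)
  · have hc' := coverMap_isProjectiveCover M'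
    have hc'' := coverMap_isProjectiveCover M''
    have := hc'.projective
    have := hc''.projective
    have h := cls_syzygy_eq M (P := coverObj M' × coverObj M'') inferInstance
      (e.symm.toLinearMap.comp ((coverMap M').prodMap (coverMap M'')))
      (e.symm.surjective.comp (Prod.map_surjective.2 ⟨hc'.surjective, hc''.surjective⟩))
    have hk (x : coverObj M' × coverObj M'') :
        x ∈ LinearMap.ker (e.symm.toLinearMap.comp ((coverMap M').prodMap (coverMap M''))) ↔
          coverMap M' x.1 = 0 ∧ coverMap M'' x.2 = 0 := by
      simp
    have h2 := cls_of_equiv_prod (R := R) (M' := LinearMap.ker (coverMap M'))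
      (M'' := LinearMap.ker (coverMap M''))
      { toFun := fun x : LinearMap.ker
            (e.symm.toLinearMap.comp ((coverMap M').prodMap (coverMap M''))) =>
          (⟨x.1.1, ((hk x.1).1 x.2).1⟩, ⟨x.1.2, ((hk x.1).1 x.2).2⟩)
        map_add' := fun x y => rfl
        map_smul' := fun r x => rfl
        invFun := fun y => ⟨(y.1.1, y.2.1), (hk _).2 ⟨y.1.2, y.2.2⟩⟩
        left_inv := fun x => rfl
        right_inv := fun y => rfl }
    have h3 : (cls (syzygy M) : K0 R) = cls (syzygy M') + cls (syzygy M'') := h.trans h2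
    rw [SetLike.mem_coe, AddMonoidHom.mem_ker, map_sub, map_sub]
    simp only [FreeAbelianGroup.lift_apply_of]
    rw [h3]
    abel
  · have h := cls_syzygy_eq P (P := P) hP LinearMap.id Function.surjective_id
    have h0 : Module.Projective R (LinearMap.ker (LinearMap.id : P →ₗ[R] P)) := by
      rw [LinearMap.ker_id]; infer_instance
    rw [cls_of_projective _ h0] at h
    simpa using h

variable (R) in
/-- The endomorphism `Ω̄` of `K₀` with `Ω̄ [M] = [Ω M]`. -/
noncomputable def syzygyHom : AddMonoid.End (K0 R) :=
  QuotientAddGroup.lift _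
    (FreeAbelianGroup.lift (fun M : FGModuleCat.{u} R => (cls (syzygy M) : K0 R)))
    lift_syzygy_eq_zero

theorem syzygyHom_cls (M : FGModuleCat.{u} R) :
    syzygyHom R (cls M) = cls (syzygy M) :=
  FreeAbelianGroup.lift_apply_of _ _

end Syzygy

section Phi

variable (R : Type u) [Ring R]

/-- A module is indecomposable: it is nonzero and is not the direct sum of two nonzero modules. -/
def Indecomposable (N : Type u) [AddCommGroup N] [Module R N] : Prop :=
  Nontrivial N ∧ ∀ X Y : FGModuleCat.{u} R, Nonempty (N ≃ₗ[R] X × Y) →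
    Subsingleton X ∨ Subsingleton Y

/-- The subgroup `⟨add M⟩` of `K₀` generated by the classes of the indecomposable direct
summands of `M`. -/
def addSpan (M : FGModuleCat.{u} R) : AddSubgroup (K0 R) :=
  AddSubgroup.closure {x | ∃ N N' : FGModuleCat.{u} R, Nonempty (M ≃ₗ[R] N × N') ∧
    Indecomposable R N ∧ x = cls N}

variable [IsArtinianRing R]

/-- The Igusa-Todorov function: the least `l` such that `Ω̄` is injective on
`Ω̄ ^ (l + s) ⟨add M⟩` for every `s` (and `⊤` if there were no such `l`). -/
noncomputable def phi (M : FGModuleCat.{u} R) : ℕ∞ :=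
  ⨅ (l : ℕ) (_ : ∀ s : ℕ, Set.InjOn (syzygyHom R)
    ((addSpan R M).map (syzygyHom R ^ (l + s)) : AddSubgroup (K0 R))), (l : ℕ∞)

/-- The supremum of `phi` over all finitely generated (left) `R`-modules. -/
noncomputable def leftModulePhiDim : ℕ∞ := ⨆ M : FGModuleCat.{u} R, phi R M

end Phi

/-- The `φ`-dimension of a finite-dimensional algebra `A`: the supremum of the Igusa-Todorov
function over all finitely generated right `A`-modules. -/
noncomputable def phiDim (K : Type v) (A : Type u) [Field K] [Ring A] [Algebra K A]
    [Module.Finite K A] : ℕ∞ :=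
  haveI : IsArtinianRing Aᵐᵒᵖ := IsArtinianRing.of_finite K Aᵐᵒᵖ
  leftModulePhiDim Aᵐᵒᵖ

/-! ### Path algebras -/

/-- A path in the quiver `V`, together with its source and its target. -/
structure QuiverPath (V : Type v) [Quiver.{w} V] where
  src : V
  tgt : V
  path : Quiver.Path src tgt

/-- The underlying space of the path algebra `K Q`: the `K`-vector space with basis the paths. -/
def PathAlgebra (K : Type u) (V : Type v) [Field K] [Quiver.{w} V] : Type _ := QuiverPath V →₀ K

namespace PathAlgebra

variable {K : Type u} {V : Type v} [Field K] [Quiver.{w} V]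

noncomputable instance : AddCommGroup (PathAlgebra K V) :=
  inferInstanceAs (AddCommGroup (QuiverPath V →₀ K))

noncomputable instance : Module K (PathAlgebra K V) :=
  inferInstanceAs (Module K (QuiverPath V →₀ K))

/-- A path, as an element of the path algebra. -/
noncomputable def ofPath (p : QuiverPath V) : PathAlgebra K V := Finsupp.single p (1 : K)

/-- The linear map with prescribed values on paths. -/
noncomputable def lift {M : Type*} [AddCommGroup M] [Module K M] (f : QuiverPath V → M) :
    PathAlgebra K V →ₗ[K] M :=
  Finsupp.linearCombination K f

theorem lift_ofPath {M : Type*} [AddCommGroup M] [Module K M] (f : QuiverPath V → M)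
    (p : QuiverPath V) : lift f (ofPath p : PathAlgebra K V) = f p := by
  refine (Finsupp.linearCombination_single K (1 : K) p).trans (one_smul K (f p))

theorem hom_ext {M : Type*} [AddCommGroup M] [Module K M] {f g : PathAlgebra K V →ₗ[K] M}
    (h : ∀ p, f (ofPath p) = g (ofPath p)) : f = g :=
  Finsupp.lhom_ext' fun p => LinearMap.ext_ring (h p)

open Classical in
/-- The product of two paths: first `p`, then `q`, if `q` starts where `p` ends, and else `0`. -/
noncomputable def mulPath (p q : QuiverPath V) : PathAlgebra K V :=
  if h : p.tgt = q.src then ofPath ⟨p.src, q.tgt, p.path.comp (q.path.cast h.symm rfl)⟩ else 0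

/-- The `K`-bilinear extension of `mulPath`. -/
noncomputable def mulHom : PathAlgebra K V →ₗ[K] PathAlgebra K V →ₗ[K] PathAlgebra K V :=
  lift fun p => lift fun q => mulPath p q

noncomputable instance : Mul (PathAlgebra K V) := ⟨fun x y => mulHom x y⟩

theorem mul_def (x y : PathAlgebra K V) : x * y = mulHom x y := rfl

theorem mulHom_ofPath (p q : QuiverPath V) :
    mulHom (ofPath p) (ofPath q) = (mulPath p q : PathAlgebra K V) := by
  rw [mulHom, lift_ofPath, lift_ofPath]

theorem mulPath_of_eq {a b c : V} (p : Quiver.Path a b) (q : Quiver.Path b c) :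
    (mulPath ⟨a, b, p⟩ ⟨b, c, q⟩ : PathAlgebra K V) = ofPath ⟨a, c, p.comp q⟩ := by
  simp [mulPath]

theorem mulPath_of_ne {p q : QuiverPath V} (h : p.tgt ≠ q.src) :
    (mulPath p q : PathAlgebra K V) = 0 := by
  simp [mulPath, h]

theorem mulHom_assoc_ofPath (p q r : QuiverPath V) :
    mulHom (mulHom (ofPath p) (ofPath q)) (ofPath r) =
      mulHom (ofPath p) (mulHom (ofPath q) (ofPath r) : PathAlgebra K V) := by
  obtain ⟨a, b, p⟩ := p
  obtain ⟨b', c, q⟩ := q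
  obtain ⟨c', d, r⟩ := r
  rw [mulHom_ofPath, mulHom_ofPath]
  by_cases hb : b = b'
  · subst hb
    by_cases hc : c = c'
    · subst hc
      simp only [mulPath_of_eq, mulHom_ofPath, Quiver.Path.comp_assoc]
    · rw [mulPath_of_eq, mulHom_ofPath, mulPath_of_ne (q := ⟨c', d, r⟩) hc,
        mulPath_of_ne (q := ⟨c', d, r⟩) hc, map_zero]
  · rw [mulPath_of_ne (q := ⟨b', c, q⟩) hb, LinearMap.map_zero₂]
    by_cases hc : c = c'
    · subst hc
      rw [mulPath_of_eq, mulHom_ofPath, mulPath_of_ne (q := ⟨b', d, _⟩) hb]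
    · rw [mulPath_of_ne (q := ⟨c', d, r⟩) hc, map_zero]

theorem mulHom_assoc (x y z : PathAlgebra K V) :
    mulHom (mulHom x y) z = mulHom x (mulHom y z) := by
  have h1 (p q : QuiverPath V) (z : PathAlgebra K V) :
      mulHom (mulHom (ofPath p) (ofPath q)) z = mulHom (ofPath p) (mulHom (ofPath q) z) := by
    have : mulHom (mulHom (ofPath p) (ofPath q)) =
        (mulHom (ofPath p)).comp (mulHom (ofPath q : PathAlgebra K V)) :=
      hom_ext fun r => mulHom_assoc_ofPath p q r
    rw [this, LinearMap.comp_apply]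
  have h2 (p : QuiverPath V) (y z : PathAlgebra K V) :
      mulHom (mulHom (ofPath p) y) z = mulHom (ofPath p) (mulHom y z) := by
    have : (mulHom.flip z).comp (mulHom (ofPath p)) =
        (mulHom (ofPath p)).comp (mulHom.flip z : PathAlgebra K V →ₗ[K] _) :=
      hom_ext fun q => h1 p q z
    exact LinearMap.congr_fun this y
  have : (mulHom.flip z).comp (mulHom.flip y) =
      (mulHom.flip (mulHom y z) : PathAlgebra K V →ₗ[K] _) :=
    hom_ext fun p => h2 p y z
  exact LinearMap.congr_fun this x

/-- The unit of the path algebra: the sum of the trivial paths. -/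
noncomputable instance [Fintype V] : One (PathAlgebra K V) :=
  ⟨∑ v : V, ofPath ⟨v, v, Quiver.Path.nil⟩⟩

theorem one_def [Fintype V] :
    (1 : PathAlgebra K V) = ∑ v : V, ofPath ⟨v, v, Quiver.Path.nil⟩ := rfl

theorem one_mulHom [Fintype V] (x : PathAlgebra K V) : mulHom 1 x = x := by
  suffices h : mulHom (1 : PathAlgebra K V) = LinearMap.id by rw [h, LinearMap.id_apply]
  refine hom_ext fun ⟨a, b, p⟩ => ?_
  rw [one_def, map_sum, LinearMap.sum_apply, Finset.sum_eq_single a]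
  · rw [mulHom_ofPath, mulPath_of_eq, Quiver.Path.nil_comp, LinearMap.id_apply]
  · intro v _ hv
    rw [mulHom_ofPath, mulPath_of_ne hv]
  · simp

theorem mulHom_one [Fintype V] (x : PathAlgebra K V) : mulHom x 1 = x := by
  suffices h : mulHom.flip (1 : PathAlgebra K V) = LinearMap.id by
    rw [← LinearMap.flip_apply, h, LinearMap.id_apply]
  refine hom_ext fun ⟨a, b, p⟩ => ?_
  rw [LinearMap.flip_apply, one_def, map_sum, Finset.sum_eq_single b]
  · rw [mulHom_ofPath, mulPath_of_eq, Quiver.Path.comp_nil, LinearMap.id_apply]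
  · intro v _ hv
    rw [mulHom_ofPath, mulPath_of_ne hv.symm]
  · simp

noncomputable instance [Fintype V] : Ring (PathAlgebra K V) where
  __ := (inferInstance : AddCommGroup (PathAlgebra K V))
  left_distrib x y z := map_add (mulHom x) y z
  right_distrib x y z := LinearMap.map_add₂ mulHom x y z
  zero_mul x := LinearMap.map_zero₂ mulHom x
  mul_zero x := map_zero (mulHom x)
  mul_assoc := mulHom_assoc
  one_mul := one_mulHom
  mul_one := mulHom_one

noncomputable instance [Fintype V] : Algebra K (PathAlgebra K V) :=
  Algebra.ofModule (fun r x y => LinearMap.map_smul₂ mulHom r x y)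
    (fun r x y => map_smul (mulHom x) r y)

end PathAlgebra

section RadicalSquareZero

variable (K : Type u) (V : Type v) [Field K] [Quiver.{w} V] [Fintype V]

/-- The two-sided ideal `J` of the path algebra generated by the arrows. -/
noncomputable def arrowIdeal : TwoSidedIdeal (PathAlgebra K V) :=
  TwoSidedIdeal.span
    {x | ∃ (a b : V) (e : a ⟶ b), x = PathAlgebra.ofPath ⟨a, b, e.toPath⟩}

/-- The algebra `K Q / J ^ 2`. -/
abbrev RadSqZeroAlgebra : Type _ := PathAlgebra K V ⧸ (arrowIdeal K V).asIdeal ^ 2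

end RadicalSquareZero

/-- A quiver is connected if it has a vertex and any two vertices are joined by a path in the
underlying graph, that is, by arrows traversed in either direction. -/
def QuiverConnected (V : Type v) [Quiver.{w} V] : Prop :=
  Nonempty V ∧ ∀ a b : V, Nonempty (@Quiver.Path (Quiver.Symmetrify V) _ a b)

end IgusaTodorov

/-! Every class of `K₀` lies in some `⟨add M⟩`, so bounding `φ` on all modules amounts to comparing
the kernels of `Ω̄ ^ k` and `Ω̄ ^ (k + 1)` on the whole of `K₀`. The `φ`-dimension is therefore
determined by the set of `k` for which these kernels agree (`leftModulePhiDim_le_iff`), and it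
suffices that reversing the arrows preserves this set.

For positive exponents, radical square zero makes every syzygy semisimple, with constituents at
targets of arrows (`syzygyHom_mem_closure_simple`). A simple module at a vertex where no arrow
starts is projective and vanishes in `K₀`; the other simple classes are linearly independent, since
`mult` recovers the multiplicity of such a simple as a direct summand (`simpleComb_eq_zero_iff`).
Conversely, every simple at a vertex of `W = range s ∩ range t` is itself a syzygy. Hence the image
of `Ω̄` is free on the simples of `W`, and there `Ω̄` multiplies row vectors by the matrix `N`
counting arrows inside `W`. The kernels of `Ω̄ ^ (k + 1)` and `Ω̄ ^ (k + 2)` agree iff the left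
kernels of `N ^ k` and `N ^ (k + 1)` do (`syzygyStable_succ_iff`), that is, iff these powers have
equal rational rank. Reversing the arrows keeps `W` and transposes `N`, which preserves ranks.

For exponent zero, classes outside the image of `Ω̄` matter. There `Ω̄` is injective iff distinct
arrows have distinct sources and distinct targets and each target is also a source: the quiver is a
union of oriented cycles and isolated vertices. By counting, this condition is symmetric in `s` and
`t`. -/

namespace IgusaTodorov

/-! ### Classes in `K₀`: splittings, induction and the universal property. -/

section Classes

variable {R : Type u} [Ring R]

theorem cls_of_subsingleton (M : Type u) [AddCommGroup M] [Module R M] [Module.Finite R M]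
    [Subsingleton M] : (cls M : K0 R) = 0 :=
  cls_of_projective M inferInstance

theorem cls_congr {M N : Type u} [AddCommGroup M] [Module R M] [Module.Finite R M]
    [AddCommGroup N] [Module R N] [Module.Finite R N] (e : M ≃ₗ[R] N) :
    (cls M : K0 R) = cls N := by
  have h := cls_of_equiv_prod
    (e.trans (LinearEquiv.prodUnique (R := R) (M := N) (M₂ := PUnit.{u + 1})).symm)
  rwa [cls_of_subsingleton PUnit, add_zero] at h

/-- A split epimorphism exhibits its source as the sum of its target and its kernel. -/
def splitEquiv {X Y : Type*} [AddCommGroup X] [Module R X] [AddCommGroup Y] [Module R Y]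
    (f : X →ₗ[R] Y) (g : Y →ₗ[R] X) (h : ∀ y, f (g y) = y) : X ≃ₗ[R] Y × LinearMap.ker f where
  toFun x := (f x, ⟨x - g (f x), by simp [h]⟩)
  map_add' x y := by ext <;> simp; abel
  map_smul' r x := by ext <;> simp [smul_sub]
  invFun z := g z.1 + z.2
  left_inv x := by simp
  right_inv z := by ext <;> simp [h]

theorem cls_eq_add_ker [IsNoetherianRing R] {X Y : Type u} [AddCommGroup X] [Module R X]
    [Module.Finite R X] [AddCommGroup Y] [Module R Y] [Module.Finite R Y]
    (f : X →ₗ[R] Y) (g : Y →ₗ[R] X) (h : ∀ y, f (g y) = y) :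
    (cls X : K0 R) = cls Y + cls (LinearMap.ker f) :=
  cls_of_equiv_prod (splitEquiv f g h)

theorem cls_eq_ker_of_projective [IsNoetherianRing R] {X Y : Type u} [AddCommGroup X] [Module R X]
    [Module.Finite R X] [AddCommGroup Y] [Module R Y] [Module.Finite R Y]
    (hY : Module.Projective R Y) (f : X →ₗ[R] Y) (hf : Function.Surjective f) :
    (cls X : K0 R) = cls (LinearMap.ker f) := by
  obtain ⟨g, hg⟩ := Module.projective_lifting_property f LinearMap.id hf
  rw [cls_eq_add_ker f g (LinearMap.congr_fun hg), cls_of_projective Y hY, zero_add]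

theorem cls_sup_of_disjoint [IsNoetherianRing R] {X : Type u} [AddCommGroup X] [Module R X]
    [Module.Finite R X] {p q : Submodule R X} (h : Disjoint p q) :
    (cls (p ⊔ q : Submodule R X) : K0 R) = cls p + cls q := by
  have hinj : Function.Injective (p.subtype.coprod q.subtype) := by
    rw [← LinearMap.ker_eq_bot, LinearMap.ker_coprod_of_disjoint_range _ _ (by simpa using h)]
    simp
  have hr : LinearMap.range (p.subtype.coprod q.subtype) = p ⊔ q := by
    simp [LinearMap.range_coprod]
  exact cls_of_equiv_prod
    ((LinearEquiv.ofInjective _ hinj).trans (LinearEquiv.ofEq _ _ hr)).symm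

theorem K0_induction {p : K0 R → Prop} (zero : p 0)
    (cls : ∀ M : FGModuleCat.{u} R, p (cls M)) (neg : ∀ x, p x → p (-x))
    (add : ∀ x y, p x → p y → p (x + y)) (x : K0 R) : p x := by
  obtain ⟨x, rfl⟩ := QuotientAddGroup.mk_surjective x
  induction x using FreeAbelianGroup.induction_on with
  | zero => exact zero
  | of M => exact cls M
  | neg M h => exact neg _ h
  | add x y hx hy => exact add _ _ hx hy

/-- The homomorphism on `K₀` induced by a function on modules that is additive on direct sums and
vanishes on projective modules. -/
def K0.liftHom {G : Type*} [AddCommGroup G] (f : FGModuleCat.{u} R → G)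
    (hadd : ∀ M M' M'' : FGModuleCat.{u} R, Nonempty (M ≃ₗ[R] M' × M'') → f M = f M' + f M'')
    (hproj : ∀ P : FGModuleCat.{u} R, Module.Projective R P → f P = 0) : K0 R →+ G :=
  QuotientAddGroup.lift _ (FreeAbelianGroup.lift f) <| by
    refine (AddSubgroup.closure_le _).2 ?_
    rintro _ (⟨M, M', M'', h, rfl⟩ | ⟨P, hP, rfl⟩)
    · simp [AddMonoidHom.mem_ker, hadd M M' M'' h]
    · simp [AddMonoidHom.mem_ker, hproj P hP]

theorem K0.liftHom_cls {G : Type*} [AddCommGroup G] (f : FGModuleCat.{u} R → G)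
    (hadd : ∀ M M' M'' : FGModuleCat.{u} R, Nonempty (M ≃ₗ[R] M' × M'') → f M = f M' + f M'')
    (hproj : ∀ P : FGModuleCat.{u} R, Module.Projective R P → f P = 0) (M : Type u)
    [AddCommGroup M] [Module R M] [Module.Finite R M] :
    K0.liftHom f hadd hproj (cls M) = f (FGModuleCat.of R M) :=
  FreeAbelianGroup.lift_apply_of _ _

end Classes

/-! ### The `φ`-dimension in terms of the kernels of the powers of `Ω̄`. -/

section PhiDim

variable {R : Type u} [Ring R] [IsArtinianRing R]

/-- Induction on length: a decomposable summand splits into two shorter ones, and each of these is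
again a summand of `M` once the other is absorbed into the complement. -/
theorem cls_summand_mem_addSpan (M : FGModuleCat.{u} R) (N N' : FGModuleCat.{u} R)
    (e : M ≃ₗ[R] N × N') : cls N ∈ addSpan R M := by
  induction hl : Module.length R N using WellFoundedLT.induction generalizing N N' with
  | ind l ih =>
    subst hl
    rcases subsingleton_or_nontrivial N with hN | hN
    · rw [cls_of_subsingleton]
      exact zero_mem _
    by_cases hI : Indecomposable R N
    · exact AddSubgroup.subset_closure ⟨N, N', ⟨e⟩, hI, rfl⟩
    · simp only [Indecomposable, hN, true_and, not_forall, not_or, not_subsingleton_iff_nontrivial]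
        at hI
      obtain ⟨X, Y, ⟨f⟩, hX, hY⟩ := hI
      have hlen : Module.length R N = Module.length R X + Module.length R Y := by
        rw [f.length_eq, Module.length_prod]
      have hX' : Module.length R X ≠ ⊤ := Module.length_ne_top
      have hY' : Module.length R Y ≠ ⊤ := Module.length_ne_top
      have hX0 : 0 < Module.length R X := Module.length_pos
      have hY0 : 0 < Module.length R Y := Module.length_pos
      rw [cls_of_equiv_prod f]
      refine add_mem (ih _ ?_ X (FGModuleCat.of R (Y × N')) ?_ rfl)
        (ih _ ?_ Y (FGModuleCat.of R (X × N')) ?_ rfl)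
      · rw [hlen]
        exact (add_zero _).symm.trans_lt (WithTop.add_lt_add_left hX' hY0)
      · exact e.trans ((f.prodCongr (LinearEquiv.refl R _)).trans (LinearEquiv.prodAssoc R _ _ _))
      · rw [hlen, add_comm]
        exact (add_zero _).symm.trans_lt (WithTop.add_lt_add_left hY' hX0)
      · exact e.trans ((((f.trans (LinearEquiv.prodComm R _ _)).prodCongr
          (LinearEquiv.refl R _)).trans (LinearEquiv.prodAssoc R _ _ _)))

theorem addSpan_mono_of_equiv {M N N' : FGModuleCat.{u} R} (e : M ≃ₗ[R] N × N') :
    addSpan R N ≤ addSpan R M := by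
  refine (AddSubgroup.closure_le _).2 ?_
  rintro _ ⟨X, X', ⟨f⟩, -, rfl⟩
  exact cls_summand_mem_addSpan M X (FGModuleCat.of R (X' × N'))
    (e.trans ((f.prodCongr (LinearEquiv.refl R _)).trans (LinearEquiv.prodAssoc R _ _ _)))

/-- A sum of two classes is handled by the direct sum of the corresponding modules. This lets the
supremum over `M` see all of `K₀`. -/
theorem exists_mem_addSpan (x : K0 R) : ∃ M : FGModuleCat.{u} R, x ∈ addSpan R M := by
  induction x using K0_induction with
  | zero => exact ⟨FGModuleCat.of R PUnit, zero_mem _⟩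
  | cls M =>
    exact ⟨M, cls_summand_mem_addSpan M M (FGModuleCat.of R PUnit.{u + 1})
      (LinearEquiv.prodUnique (R := R) (M := M) (M₂ := PUnit.{u + 1})).symm⟩
  | neg x hx => exact ⟨hx.choose, neg_mem hx.choose_spec⟩
  | add x y hx hy =>
    obtain ⟨M, hM⟩ := hx
    obtain ⟨N, hN⟩ := hy
    exact ⟨FGModuleCat.of R (M × N), add_mem
      (addSpan_mono_of_equiv (LinearEquiv.refl R (M × N)) hM)
      (addSpan_mono_of_equiv (LinearEquiv.prodComm R M N) hN)⟩

theorem syzygyHom_pow_succ_apply (k : ℕ) (x : K0 R) :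
    (syzygyHom R ^ (k + 1)) x = syzygyHom R ((syzygyHom R ^ k) x) := by
  rw [pow_succ']
  rfl

theorem syzygyHom_pow_succ_apply' (k : ℕ) (x : K0 R) :
    (syzygyHom R ^ (k + 1)) x = (syzygyHom R ^ k) (syzygyHom R x) := by
  rw [pow_succ]
  rfl

variable (R) in
/-- The kernels of `Ω̄ ^ k` and `Ω̄ ^ (k + 1)` agree. -/
def SyzygyStable (k : ℕ) : Prop :=
  ∀ x : K0 R, (syzygyHom R ^ (k + 1)) x = 0 → (syzygyHom R ^ k) x = 0

/-- The admissible `l` form an upper set, since raising `l` only discards some values of `s`; so a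
finite infimum is attained. -/
theorem le_phi_iff_injOn (M : FGModuleCat.{u} R) (l : ℕ) :
    phi R M ≤ l ↔ ∀ s : ℕ, Set.InjOn (syzygyHom R)
      ((addSpan R M).map (syzygyHom R ^ (l + s)) : AddSubgroup (K0 R)) := by
  constructor
  · intro h
    have h' : phi R M < ((l + 1 : ℕ) : ℕ∞) :=
      lt_of_le_of_lt h (by exact_mod_cast Nat.lt_succ_self l)
    rw [phi, iInf_lt_iff] at h'
    obtain ⟨m, hm⟩ := h'
    rw [iInf_lt_iff] at hm
    obtain ⟨hm, hlt⟩ := hm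
    have hml : m ≤ l := Nat.lt_succ_iff.1 (by exact_mod_cast hlt)
    intro s
    have := hm (l - m + s)
    rwa [← add_assoc, Nat.add_sub_cancel' hml] at this
  · intro h
    exact iInf₂_le l h

/-- Injectivity on every `Ω̄ ^ k ⟨add M⟩` becomes a condition on kernels over `K₀`: apply it to an
element and `0` in one direction, and to a difference in the other. -/
theorem leftModulePhiDim_le_iff (l : ℕ) :
    leftModulePhiDim R ≤ l ↔ ∀ k, l ≤ k → SyzygyStable R k := by
  simp only [leftModulePhiDim, iSup_le_iff, le_phi_iff_injOn]
  constructor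
  · intro h k hk x hx
    obtain ⟨M, hM⟩ := exists_mem_addSpan x
    have := h M (k - l)
    rw [Nat.add_sub_cancel' hk] at this
    refine this ⟨x, hM, rfl⟩ (zero_mem _) ?_
    exact ((syzygyHom_pow_succ_apply k x).symm.trans hx).trans (map_zero _).symm
  · rintro h M s _ ⟨x, -, rfl⟩ _ ⟨y, -, rfl⟩ hxy
    have := h (l + s) (Nat.le_add_right _ _) (x - y)
    rw [syzygyHom_pow_succ_apply, map_sub, map_sub, sub_eq_zero, sub_eq_zero] at this
    exact this hxy

/-- An element of `ℕ∞` is determined by its natural upper bounds. -/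
theorem leftModulePhiDim_congr {S : Type v} [Ring S] [IsArtinianRing S]
    (h : ∀ k, SyzygyStable R k ↔ SyzygyStable S k) :
    leftModulePhiDim R = leftModulePhiDim S := by
  have h (l : ℕ) : leftModulePhiDim R ≤ l ↔ leftModulePhiDim S ≤ l := by
    simp only [leftModulePhiDim_le_iff, h]
  refine le_antisymm ?_ ?_
  · cases hS : leftModulePhiDim S with
    | top => exact le_top
    | coe l => exact (h l).2 hS.le
  · cases hR : leftModulePhiDim R with
    | top => exact le_top
    | coe l => exact (h l).1 hR.le

theorem syzygyHom_cls_of_surjective {M P : Type u} [AddCommGroup M] [Module R M]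
    [Module.Finite R M] [AddCommGroup P] [Module R P] [Module.Finite R P]
    (hP : Module.Projective R P) (p : P →ₗ[R] M) (hp : Function.Surjective p) :
    syzygyHom R (cls M) = cls (LinearMap.ker p) :=
  (syzygyHom_cls (FGModuleCat.of R M)).trans (cls_syzygy_eq (FGModuleCat.of R M) hP p hp)

theorem syzygyHom_cls_quotient {P : Type u} [AddCommGroup P] [Module R P] [Module.Finite R P]
    (hP : Module.Projective R P) (N : Submodule R P) :
    syzygyHom R (cls (P ⧸ N)) = cls N := by
  rw [syzygyHom_cls_of_surjective hP N.mkQ N.mkQ_surjective]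
  exact cls_congr (LinearEquiv.ofEq _ _ N.ker_mkQ)

end PhiDim

/-- A basis of an algebra that consists of orthogonal idempotents `e v` indexed by the vertices
and of elements `a i` indexed by the arrows of a quiver, the product of any two arrows being zero:
`e (t i) * a i * e (s i) = a i`. -/
structure RadSqZeroBasis (K : Type*) (B : Type*) {V E : Type*} [Field K] [Ring B] [Algebra K B]
    (s t : E → V) where
  basis : Module.Basis (V ⊕ E) K B
  vertex_mul_self : ∀ v, basis (.inl v) * basis (.inl v) = basis (.inl v)
  vertex_mul_vertex : ∀ {v w}, v ≠ w → basis (.inl v) * basis (.inl w) = 0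
  vertex_mul_arrow : ∀ i, basis (.inl (t i)) * basis (.inr i) = basis (.inr i)
  vertex_mul_arrow_of_ne : ∀ {v i}, v ≠ t i → basis (.inl v) * basis (.inr i) = 0
  arrow_mul_vertex : ∀ i, basis (.inr i) * basis (.inl (s i)) = basis (.inr i)
  arrow_mul_vertex_of_ne : ∀ {v i}, v ≠ s i → basis (.inr i) * basis (.inl v) = 0
  arrow_mul_arrow : ∀ i j, basis (.inr i) * basis (.inr j) = 0

namespace RadSqZeroBasis

/-! ### Multiplication in a radical square zero algebra. -/

section Algebra

variable {K : Type*} {B : Type*} {V E : Type*} [Field K] [Ring B] [Algebra K B] {s t : E → V}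
  (D : RadSqZeroBasis K B s t)

/-- The idempotent of a vertex. -/
noncomputable def e (v : V) : B := D.basis (.inl v)

/-- The basis element of an arrow. -/
noncomputable def a (i : E) : B := D.basis (.inr i)

/-- The coordinate of a vertex. -/
noncomputable def vc (v : V) : B →ₗ[K] K := D.basis.coord (.inl v)

/-- The coordinate of an arrow. -/
noncomputable def ac (i : E) : B →ₗ[K] K := D.basis.coord (.inr i)

theorem e_mul_e_self (v : V) : D.e v * D.e v = D.e v := D.vertex_mul_self v

theorem e_mul_e {v w : V} (h : v ≠ w) : D.e v * D.e w = 0 := D.vertex_mul_vertex h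

theorem e_mul_a_self (i : E) : D.e (t i) * D.a i = D.a i := D.vertex_mul_arrow i

theorem e_mul_a {v : V} {i : E} (h : v ≠ t i) : D.e v * D.a i = 0 := D.vertex_mul_arrow_of_ne h

theorem a_mul_e_self (i : E) : D.a i * D.e (s i) = D.a i := D.arrow_mul_vertex i

theorem a_mul_e {v : V} {i : E} (h : v ≠ s i) : D.a i * D.e v = 0 := D.arrow_mul_vertex_of_ne h

theorem a_mul_a (i j : E) : D.a i * D.a j = 0 := D.arrow_mul_arrow i j

theorem vc_e_self (v : V) : D.vc v (D.e v) = 1 := by simp [vc, e]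

theorem vc_e {v w : V} (h : v ≠ w) : D.vc v (D.e w) = 0 := by simp [vc, e, h.symm]

theorem vc_a (v : V) (i : E) : D.vc v (D.a i) = 0 := by simp [vc, a]

theorem ac_a_self (i : E) : D.ac i (D.a i) = 1 := by simp [ac, a]

theorem ac_a {i j : E} (h : i ≠ j) : D.ac i (D.a j) = 0 := by simp [ac, a, h.symm]

theorem a_ne_zero (i : E) : D.a i ≠ 0 := D.basis.ne_zero _

theorem eq_zero_of_coord {b : B} (hv : ∀ v, D.vc v b = 0) (ha : ∀ i, D.ac i b = 0) : b = 0 := by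
  refine D.basis.ext_elem fun k => ?_
  rw [map_zero]
  rcases k with v | i
  · exact hv v
  · exact ha i

theorem hom_ext {X : Type*} [AddCommGroup X] [Module K X] {f g : B →ₗ[K] X}
    (he : ∀ v, f (D.e v) = g (D.e v)) (ha : ∀ i, f (D.a i) = g (D.a i)) : f = g := by
  refine D.basis.ext fun k => ?_
  rcases k with v | i
  · exact he v
  · exact ha i

theorem span_induction {p : Submodule K B} (he : ∀ v, D.e v ∈ p) (ha : ∀ i, D.a i ∈ p) (b : B) :
    b ∈ p := by
  have h : ⊤ ≤ p := by
    rw [← D.basis.span_eq, Submodule.span_le]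
    rintro _ ⟨v | i, rfl⟩
    · exact he v
    · exact ha i
  exact h trivial

include D in
theorem finite [Finite V] [Finite E] : Module.Finite K B := Module.Finite.of_basis D.basis

theorem sum_e [Fintype V] : ∑ v, D.e v = 1 := by
  classical
  have h : LinearMap.mulLeft K (∑ v, D.e v) = LinearMap.id := by
    refine D.hom_ext (fun v => ?_) fun i => ?_
    · rw [LinearMap.mulLeft_apply, Finset.sum_mul,
        Finset.sum_eq_single v (fun w _ h => D.e_mul_e h) (by simp), D.e_mul_e_self,
        LinearMap.id_apply]
    · rw [LinearMap.mulLeft_apply, Finset.sum_mul,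
        Finset.sum_eq_single (t i) (fun w _ h => D.e_mul_a h) (by simp), D.e_mul_a_self,
        LinearMap.id_apply]
  simpa using LinearMap.congr_fun h 1

/-- Only the idempotent at the target of an arrow survives left multiplication onto it. Hence the
arrows span a semisimple left module. -/
theorem mul_a (b : B) (i : E) : b * D.a i = D.vc (t i) b • D.a i := by
  have h : LinearMap.mulRight K (D.a i) = (D.vc (t i)).smulRight (D.a i) := by
    refine D.hom_ext (fun v => ?_) fun j => ?_
    · by_cases h : v = t i
      · subst h
        simp [e_mul_a_self, vc_e_self]
      · simp [D.e_mul_a h, D.vc_e (Ne.symm h)]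
    · simp [a_mul_a, vc_a]
  exact LinearMap.congr_fun h b

theorem a_mul (i : E) (b : B) : D.a i * b = D.vc (s i) b • D.a i := by
  have h : LinearMap.mulLeft K (D.a i) = (D.vc (s i)).smulRight (D.a i) := by
    refine D.hom_ext (fun v => ?_) fun j => ?_
    · by_cases h : v = s i
      · subst h
        simp [a_mul_e_self, vc_e_self]
      · simp [D.a_mul_e h, D.vc_e (Ne.symm h)]
    · simp [a_mul_a, vc_a]
  exact LinearMap.congr_fun h b

/-- Modulo the arrows the algebra is a product of copies of `K` indexed by the vertices, and the
coordinates `vc` are its characters. -/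
theorem vc_mul (v : V) (b c : B) : D.vc v (b * c) = D.vc v b * D.vc v c := by
  have h : (LinearMap.mul K B).compr₂ (D.vc v) = (LinearMap.mul K K).compl₁₂ (D.vc v) (D.vc v) := by
    refine D.hom_ext (fun w => D.hom_ext (fun w' => ?_) fun i => ?_)
      fun i => LinearMap.ext fun c => ?_
    · by_cases h : w = w'
      · subst h
        by_cases hv : v = w
        · subst hv
          simp [e_mul_e_self, vc_e_self]
        · simp [e_mul_e_self, D.vc_e hv]
      · by_cases hv : v = w
        · subst hv
          simp [D.e_mul_e h, D.vc_e h]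
        · simp [D.e_mul_e h, D.vc_e hv]
    · simp [mul_a, vc_a]
    · simp [a_mul, vc_a]
  exact LinearMap.congr_fun₂ h b c

/-- The opposite algebra, with the arrows reversed. -/
noncomputable def op : RadSqZeroBasis K Bᵐᵒᵖ t s where
  basis := D.basis.map (MulOpposite.opLinearEquiv K)
  vertex_mul_self v := MulOpposite.unop_injective (D.e_mul_e_self v)
  vertex_mul_vertex h := MulOpposite.unop_injective (D.e_mul_e h.symm)
  vertex_mul_arrow i := MulOpposite.unop_injective (D.a_mul_e_self i)
  vertex_mul_arrow_of_ne h := MulOpposite.unop_injective (D.a_mul_e h)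
  arrow_mul_vertex i := MulOpposite.unop_injective (D.e_mul_a_self i)
  arrow_mul_vertex_of_ne h := MulOpposite.unop_injective (D.e_mul_a h)
  arrow_mul_arrow i j := MulOpposite.unop_injective (D.a_mul_a j i)

/-- Transport along an isomorphism of algebras. -/
noncomputable def mapEquiv {C : Type*} [Ring C] [Algebra K C] (f : B ≃ₐ[K] C) :
    RadSqZeroBasis K C s t where
  basis := D.basis.map f.toLinearEquiv
  vertex_mul_self v := (map_mul f _ _).symm.trans (congrArg f (D.e_mul_e_self v))
  vertex_mul_vertex h :=
    (map_mul f _ _).symm.trans ((congrArg f (D.e_mul_e h)).trans (map_zero f))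
  vertex_mul_arrow i := (map_mul f _ _).symm.trans (congrArg f (D.e_mul_a_self i))
  vertex_mul_arrow_of_ne h :=
    (map_mul f _ _).symm.trans ((congrArg f (D.e_mul_a h)).trans (map_zero f))
  arrow_mul_vertex i := (map_mul f _ _).symm.trans (congrArg f (D.a_mul_e_self i))
  arrow_mul_vertex_of_ne h :=
    (map_mul f _ _).symm.trans ((congrArg f (D.a_mul_e h)).trans (map_zero f))
  arrow_mul_arrow i j :=
    (map_mul f _ _).symm.trans ((congrArg f (D.a_mul_a i j)).trans (map_zero f))

end Algebra

/-! ### Simple modules and homomorphisms built from linear functionals. -/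

section Modules

variable {K : Type*} {B : Type u} {V E : Type*} [Field K] [Ring B] [Algebra K B] {s t : E → V}
  (D : RadSqZeroBasis K B s t)

variable {X Y : Type*} [AddCommGroup X] [Module B X] [Module K X] [IsScalarTower K B X]
  [AddCommGroup Y] [Module B Y] [Module K Y] [IsScalarTower K B Y]

/-- A linear map over the field that commutes with the basis is a homomorphism of modules. -/
def homOfBasis (f : X →ₗ[K] Y) (he : ∀ v x, f (D.e v • x) = D.e v • f x)
    (ha : ∀ i x, f (D.a i • x) = D.a i • f x) : X →ₗ[B] Y where
  __ := f
  map_smul' b x := by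
    have h : f ∘ₗ (LinearMap.toSpanSingleton B X x).restrictScalars K =
        (LinearMap.toSpanSingleton B Y (f x)).restrictScalars K :=
      D.hom_ext (fun v => by simpa using he v x) fun i => by simpa using ha i x
    simpa using LinearMap.congr_fun h b

theorem smul_eq_vc_smul {v : V} {x : X} (hx : D.e v • x = x) (ha : ∀ i, D.a i • x = 0) (b : B) :
    b • x = D.vc v b • x := by
  have h : (LinearMap.toSpanSingleton B X x).restrictScalars K = (D.vc v).smulRight x := by
    refine D.hom_ext (fun w => ?_) fun i => by simp [ha, vc_a]
    by_cases hw : v = w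
    · subst hw
      simp [hx, vc_e_self]
    · have : D.e w • x = 0 := by rw [← hx, smul_smul, D.e_mul_e (Ne.symm hw), zero_smul]
      simp [D.vc_e hw, this]
  simpa using LinearMap.congr_fun h b

/-- The maximal left ideal that belongs to a vertex. -/
noncomputable def maxIdeal (v : V) : Submodule B B where
  carrier := {b | D.vc v b = 0}
  add_mem' hb hc := by simp_all
  zero_mem' := by simp
  smul_mem' b c hc := by simp_all [vc_mul]

theorem mem_maxIdeal {v : V} {b : B} : b ∈ D.maxIdeal v ↔ D.vc v b = 0 := Iff.rfl

/-- The simple module of a vertex. -/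
abbrev Simple (v : V) : Type u := B ⧸ D.maxIdeal v

/-- The generator of the simple module of a vertex. -/
noncomputable def gen (v : V) : D.Simple v := (D.maxIdeal v).mkQ 1

theorem smul_gen (v : V) (b : B) : b • D.gen v = (D.maxIdeal v).mkQ b := by
  rw [gen, ← map_smul, smul_eq_mul, mul_one]

theorem e_smul_gen_self (v : V) : D.e v • D.gen v = D.gen v := by
  rw [smul_gen, gen, ← sub_eq_zero, ← map_sub, Submodule.mkQ_apply, Submodule.Quotient.mk_eq_zero,
    mem_maxIdeal]
  have := D.vc_mul v (D.e v) 1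
  rw [mul_one, vc_e_self, one_mul] at this
  rw [map_sub, ← this, vc_e_self, sub_self]

theorem e_smul_gen {v w : V} (h : w ≠ v) : D.e w • D.gen v = 0 := by
  rw [smul_gen, Submodule.mkQ_apply, Submodule.Quotient.mk_eq_zero, mem_maxIdeal, D.vc_e h.symm]

theorem a_smul_gen (i : E) (v : V) : D.a i • D.gen v = 0 := by
  rw [smul_gen, Submodule.mkQ_apply, Submodule.Quotient.mk_eq_zero, mem_maxIdeal, vc_a]

theorem gen_ne_zero (v : V) : D.gen v ≠ 0 := by
  intro h
  have := D.smul_gen v (D.e v)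
  rw [h, smul_zero, eq_comm, Submodule.mkQ_apply, Submodule.Quotient.mk_eq_zero, mem_maxIdeal,
    vc_e_self] at this
  exact one_ne_zero this

theorem exists_eq_smul_gen {v : V} (y : D.Simple v) : ∃ k : K, y = k • D.gen v := by
  obtain ⟨b, rfl⟩ := (D.maxIdeal v).mkQ_surjective y
  exact ⟨D.vc v b, by
    rw [← smul_gen, D.smul_eq_vc_smul (D.e_smul_gen_self v) fun i => D.a_smul_gen i v]⟩

theorem a_smul_simple (i : E) {v : V} (y : D.Simple v) : D.a i • y = 0 := by
  obtain ⟨k, rfl⟩ := D.exists_eq_smul_gen y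
  rw [smul_comm, a_smul_gen, smul_zero]

/-- The map from a simple module to a module with a given value at the generator. -/
noncomputable def simpleLift {v : V} (x : X) (hx : D.e v • x = x) (ha : ∀ i, D.a i • x = 0) :
    D.Simple v →ₗ[B] X :=
  (D.maxIdeal v).liftQ (LinearMap.toSpanSingleton B X x) fun b hb => by
    rw [LinearMap.mem_ker, LinearMap.toSpanSingleton_apply, D.smul_eq_vc_smul hx ha,
      D.mem_maxIdeal.1 hb, zero_smul]

theorem simpleLift_gen {v : V} (x : X) (hx : D.e v • x = x) (ha : ∀ i, D.a i • x = 0) :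
    D.simpleLift x hx ha (D.gen v) = x := by
  rw [simpleLift, gen, Submodule.mkQ_apply, Submodule.liftQ_apply,
    LinearMap.toSpanSingleton_apply, one_smul]

/-- The map to a simple module given by a functional that vanishes on the radical. -/
noncomputable def toSimple (v : V) (l : X →ₗ[K] K) (hl : ∀ i x, l (D.a i • x) = 0) :
    X →ₗ[B] D.Simple v :=
  D.homOfBasis
    ((l ∘ₗ Algebra.lsmul K K X (D.e v)).smulRight (D.gen v))
    (fun w x => by
      by_cases h : w = v
      · subst h
        simp only [LinearMap.smulRight_apply, LinearMap.comp_apply, Algebra.lsmul_coe]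
        rw [smul_comm (D.e w) (l _) (D.gen w), e_smul_gen_self, smul_smul, e_mul_e_self]
      · simp only [LinearMap.smulRight_apply, LinearMap.comp_apply, Algebra.lsmul_coe]
        rw [smul_comm (D.e w) (l _) (D.gen v), D.e_smul_gen h, smul_smul, D.e_mul_e (Ne.symm h)]
        simp)
    (fun i x => by
      simp only [LinearMap.smulRight_apply, LinearMap.comp_apply, Algebra.lsmul_coe]
      rw [smul_comm (D.a i) (l _) (D.gen v), a_smul_gen, smul_smul, smul_zero]
      by_cases h : v = t i
      · rw [h, e_mul_a_self, hl, zero_smul]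
      · rw [D.e_mul_a h, zero_smul, map_zero, zero_smul])

theorem toSimple_apply (v : V) (l : X →ₗ[K] K) (hl : ∀ i x, l (D.a i • x) = 0) (x : X) :
    D.toSimple v l hl x = l (D.e v • x) • D.gen v := rfl

omit [Module K X] [IsScalarTower K B X] in
theorem exists_e_smul_ne_zero [Fintype V] {x : X} (hx : x ≠ 0) : ∃ v, D.e v • x ≠ 0 := by
  by_contra! h
  apply hx
  rw [← one_smul B x, ← D.sum_e, Finset.sum_smul, Finset.sum_eq_zero fun v _ => h v]

end Modules

/-! ### Left ideals spanned by arrows, indecomposable projectives and syzygies of simples. -/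

section Classes

variable {K : Type*} {B : Type u} {V E : Type*} [Field K] [Ring B] [Algebra K B] {s t : E → V}
  (D : RadSqZeroBasis K B s t)

/-- The left ideal spanned by a set of arrows. -/
noncomputable def arrowSpan (I : Set E) : Submodule B B := Submodule.span B (D.a '' I)

theorem a_mem_arrowSpan {I : Set E} {i : E} (hi : i ∈ I) : D.a i ∈ D.arrowSpan I :=
  Submodule.subset_span ⟨i, hi, rfl⟩

/-- By `mul_a`, the `K`-span of a set of arrows is already a left ideal, so `K`-linear conditions
need only be tested on the arrows. -/
theorem arrowSpan_le_of_arrows {I : Set E} {p : Submodule K B} (h : ∀ i ∈ I, D.a i ∈ p) {b : B}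
    (hb : b ∈ D.arrowSpan I) : b ∈ p := by
  have h1 : Submodule.span K (D.a '' I) ≤ p :=
    Submodule.span_le.2 (by rintro _ ⟨i, hi, rfl⟩; exact h i hi)
  refine h1 ?_
  refine Submodule.span_induction (p := fun x _ => x ∈ Submodule.span K (D.a '' I))
    (fun x hx => Submodule.subset_span hx) (zero_mem _) (fun x y _ _ hx hy => add_mem hx hy)
    (fun c x _ hx => ?_) hb
  have h2 : Submodule.span K (D.a '' I) ≤
      (Submodule.span K (D.a '' I)).comap (LinearMap.mulLeft K c) := by
    refine Submodule.span_le.2 ?_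
    rintro _ ⟨i, hi, rfl⟩
    simp only [SetLike.mem_coe, Submodule.mem_comap, LinearMap.mulLeft_apply, mul_a]
    exact Submodule.smul_mem _ _ (Submodule.subset_span ⟨i, hi, rfl⟩)
  exact h2 hx

theorem vc_of_mem_arrowSpan {I : Set E} {b : B} (hb : b ∈ D.arrowSpan I) (v : V) :
    D.vc v b = 0 :=
  D.arrowSpan_le_of_arrows (p := LinearMap.ker (D.vc v)) (fun i _ => D.vc_a v i) hb

theorem ac_of_mem_arrowSpan {I : Set E} {b : B} (hb : b ∈ D.arrowSpan I) {i : E} (hi : i ∉ I) :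
    D.ac i b = 0 :=
  D.arrowSpan_le_of_arrows (p := LinearMap.ker (D.ac i))
    (fun j hj => D.ac_a (by rintro rfl; exact hi hj)) hb

theorem disjoint_arrowSpan {I J : Set E} (h : Disjoint I J) :
    Disjoint (D.arrowSpan I) (D.arrowSpan J) := by
  rw [Submodule.disjoint_def]
  intro x hx hy
  refine D.eq_zero_of_coord (D.vc_of_mem_arrowSpan hx) fun i => ?_
  by_cases hi : i ∈ I
  · exact D.ac_of_mem_arrowSpan hy (Set.disjoint_left.1 h hi)
  · exact D.ac_of_mem_arrowSpan hx hi

theorem arrowSpan_union (I J : Set E) : D.arrowSpan (I ∪ J) = D.arrowSpan I ⊔ D.arrowSpan J := by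
  rw [arrowSpan, Set.image_union, Submodule.span_union]
  rfl

/-- The indecomposable projective module of a vertex. -/
def proj (v : V) : Submodule B B where
  carrier := {b | b * D.e v = b}
  add_mem' hb hc := by simp_all [add_mul]
  zero_mem' := by simp
  smul_mem' b c hc := by simp_all [mul_assoc]

theorem mem_proj {v : V} {b : B} : b ∈ D.proj v ↔ b * D.e v = b := Iff.rfl

theorem mul_e_mem_proj (b : B) (v : V) : b * D.e v ∈ D.proj v := by
  rw [mem_proj, mul_assoc, e_mul_e_self]

theorem projective_proj (v : V) : Module.Projective B (D.proj v) :=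
  Module.Projective.of_split (D.proj v).subtype
    ((LinearMap.toSpanSingleton B B (D.e v)).codRestrict (D.proj v) (D.mul_e_mem_proj · v))
    (LinearMap.ext fun x => Subtype.ext x.2)

theorem arrowSpan_le_proj {v : V} {I : Set E} (hI : ∀ i ∈ I, s i = v) :
    D.arrowSpan I ≤ D.proj v := by
  refine Submodule.span_le.2 ?_
  rintro _ ⟨i, hi, rfl⟩
  rw [SetLike.mem_coe, mem_proj, ← hI i hi, a_mul_e_self]

/-- The map `b ↦ b * e v - vc v b • e v` sends each basis element to `0` or to an arrow starting at
`v`. -/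
theorem sub_vc_smul_e_mem {v : V} {b : B} (hb : b ∈ D.proj v) :
    b - D.vc v b • D.e v ∈ D.arrowSpan {i | s i = v} := by
  have h := D.span_induction (p := ((D.arrowSpan {i | s i = v}).restrictScalars K).comap
    (LinearMap.mulRight K (D.e v) - (D.vc v).smulRight (D.e v))) (fun w => ?_) (fun i => ?_) b
  · simpa [D.mem_proj.1 hb] using h
  · by_cases hw : v = w
    · subst hw
      simp [e_mul_e_self, vc_e_self]
    · simp [D.e_mul_e (Ne.symm hw), D.vc_e hw]
  · by_cases hi : v = s i
    · subst hi
      simpa [a_mul_e_self, vc_a] using D.a_mem_arrowSpan (I := {j | s j = s i}) (i := i) rfl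
    · simp [D.a_mul_e hi, D.vc_a]

theorem mem_arrowSpan_of_mem_proj {v : V} {b : B} (hb : b ∈ D.proj v) (h : D.vc v b = 0) :
    b ∈ D.arrowSpan {i | s i = v} := by
  simpa [h] using D.sub_vc_smul_e_mem hb

theorem e_mem_proj (v : V) : D.e v ∈ D.proj v := D.e_mul_e_self v

/-- The projection from an indecomposable projective module to its top. -/
noncomputable def projToSimple (v : V) : D.proj v →ₗ[B] D.Simple v :=
  (D.maxIdeal v).mkQ ∘ₗ (D.proj v).subtype

theorem projToSimple_surjective (v : V) : Function.Surjective (D.projToSimple v) := by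
  intro y
  obtain ⟨b, rfl⟩ := (D.maxIdeal v).mkQ_surjective y
  refine ⟨⟨b * D.e v, D.mul_e_mem_proj b v⟩, ?_⟩
  change (D.maxIdeal v).mkQ (b * D.e v) = _
  rw [← sub_eq_zero, ← map_sub, Submodule.mkQ_apply, Submodule.Quotient.mk_eq_zero, mem_maxIdeal,
    map_sub, vc_mul, vc_e_self, mul_one, sub_self]

theorem ker_projToSimple (v : V) :
    LinearMap.ker (D.projToSimple v) = (D.arrowSpan {i | s i = v}).submoduleOf (D.proj v) := by
  ext ⟨b, hb⟩
  rw [LinearMap.mem_ker, projToSimple, LinearMap.comp_apply, Submodule.mkQ_apply,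
    Submodule.Quotient.mk_eq_zero, mem_maxIdeal]
  exact ⟨D.mem_arrowSpan_of_mem_proj hb, fun h => D.vc_of_mem_arrowSpan h v⟩

/-- With no arrow starting at `v`, the radical of `proj v` is zero and `proj v` equals its top. -/
theorem projective_simple {v : V} (hv : ∀ i, s i ≠ v) : Module.Projective B (D.Simple v) := by
  have := D.projective_proj v
  refine Module.Projective.of_equiv (LinearEquiv.ofBijective (D.projToSimple v)
    ⟨?_, D.projToSimple_surjective v⟩)
  rw [← LinearMap.ker_eq_bot, ker_projToSimple, eq_bot_iff]
  rintro ⟨b, hb⟩ h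
  have hI : {i | s i = v} = ∅ := by simpa [Set.eq_empty_iff_forall_notMem] using hv
  rw [hI, arrowSpan, Set.image_empty, Submodule.span_empty] at h
  simpa [Submodule.submoduleOf] using h

/-- The quotient of an indecomposable projective module by a set of arrows. -/
abbrev projQuot (v : V) (I : Set E) : Type u :=
  D.proj v ⧸ (D.arrowSpan I).submoduleOf (D.proj v)

variable [IsArtinianRing B]

omit [IsArtinianRing B] in
theorem cls_simple_of_forall_ne {v : V} (hv : ∀ i, s i ≠ v) : (cls (D.Simple v) : K0 B) = 0 :=
  cls_of_projective _ (D.projective_simple hv)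

theorem cls_arrowSpan_union {I J : Set E} (h : Disjoint I J) :
    (cls (D.arrowSpan (I ∪ J)) : K0 B) = cls (D.arrowSpan I) + cls (D.arrowSpan J) := by
  rw [← cls_sup_of_disjoint (D.disjoint_arrowSpan h)]
  exact cls_congr (LinearEquiv.ofEq _ _ (D.arrowSpan_union I J))

theorem cls_arrowSpan_singleton (i : E) :
    (cls (D.arrowSpan {i}) : K0 B) = cls (D.Simple (t i)) := by
  let f : D.Simple (t i) →ₗ[B] B := D.simpleLift (D.a i) (D.e_mul_a_self i) (D.a_mul_a · i)
  have hf : f (D.gen (t i)) = D.a i := D.simpleLift_gen _ _ _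
  have hinj : Function.Injective f := by
    rw [← LinearMap.ker_eq_bot, LinearMap.ker_eq_bot']
    intro y hy
    obtain ⟨k, rfl⟩ := D.exists_eq_smul_gen y
    rw [LinearMap.map_smul_of_tower, hf, smul_eq_zero, or_iff_left (D.a_ne_zero i)] at hy
    rw [hy, zero_smul]
  have hr : LinearMap.range f = D.arrowSpan {i} := by
    rw [arrowSpan, Set.image_singleton]
    refine le_antisymm ?_ ((Submodule.span_singleton_le_iff_mem _ _).2 ⟨_, hf⟩)
    rintro _ ⟨y, rfl⟩
    obtain ⟨b, rfl⟩ := (D.maxIdeal (t i)).mkQ_surjective y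
    rw [← smul_gen, map_smul, hf]
    exact Submodule.smul_mem _ _ (Submodule.mem_span_singleton_self _)
  exact cls_congr ((LinearEquiv.ofInjective f hinj).trans (LinearEquiv.ofEq _ _ hr)).symm

theorem cls_arrowSpan (I : Finset E) :
    (cls (D.arrowSpan I) : K0 B) = ∑ i ∈ I, cls (D.Simple (t i)) := by
  classical
  induction I using Finset.induction_on with
  | empty =>
    have : Subsingleton (D.arrowSpan ((∅ : Finset E) : Set E)) := by
      rw [Submodule.subsingleton_iff_eq_bot]
      simp [arrowSpan]
    rw [cls_of_subsingleton, Finset.sum_empty]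
  | insert i I hi ih =>
    rw [Finset.sum_insert hi, ← ih, ← cls_arrowSpan_singleton, ← cls_arrowSpan_union]
    · exact cls_congr (LinearEquiv.ofEq _ _ (by rw [Finset.coe_insert, Set.insert_eq]))
    · simpa using hi

theorem syzygyHom_cls_simple_eq_cls_arrowSpan (v : V) :
    syzygyHom B (cls (D.Simple v)) = cls (D.arrowSpan {i | s i = v}) :=
  (syzygyHom_cls_of_surjective (D.projective_proj v) _ (D.projToSimple_surjective v)).trans
    (cls_congr ((LinearEquiv.ofEq _ _ (D.ker_projToSimple v)).trans
      (Submodule.submoduleOfEquivOfLe (D.arrowSpan_le_proj fun _ hi => hi))))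

theorem syzygyHom_cls_simple [Fintype E] [DecidableEq V] (v : V) :
    syzygyHom B (cls (D.Simple v)) =
      ∑ i with s i = v, (cls (D.Simple (t i)) : K0 B) := by
  rw [syzygyHom_cls_simple_eq_cls_arrowSpan, ← cls_arrowSpan, Finset.coe_filter_univ]

/-- The syzygy of the simple at `v` involves all arrows starting there; these quotients realise any
subset of them. -/
theorem syzygyHom_cls_projQuot {v : V} {I : Set E} (hI : ∀ i ∈ I, s i = v) :
    syzygyHom B (cls (D.projQuot v I)) = cls (D.arrowSpan I) :=
  (syzygyHom_cls_quotient (D.projective_proj v) _).trans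
    (cls_congr (Submodule.submoduleOfEquivOfLe (D.arrowSpan_le_proj hI)))

end Classes

/-! ### Semisimplicity of syzygies. -/

section Syzygies

variable {K : Type*} {B : Type u} {V E : Type*} [Field K] [Ring B] [Algebra K B] {s t : E → V}
  (D : RadSqZeroBasis K B s t)

/-- The part of the radical of a module that belongs to a set of vertices. -/
noncomputable def radPart (X : Type*) [AddCommGroup X] [Module B X] [Module K X] (W : Set V) :
    Submodule K X :=
  Submodule.span K {y : X | ∃ i z, t i ∈ W ∧ y = D.a i • z}

theorem a_smul_mem_radPart {X : Type*} [AddCommGroup X] [Module B X] [Module K X] {W : Set V}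
    {i : E} (hi : t i ∈ W) (z : X) : D.a i • z ∈ D.radPart X W :=
  Submodule.subset_span ⟨i, z, hi, rfl⟩

theorem radPart_le {X : Type*} [AddCommGroup X] [Module B X] [Module K X] {W : Set V}
    {p : Submodule K X} (h : ∀ i z, t i ∈ W → D.a i • z ∈ p) : D.radPart X W ≤ p :=
  Submodule.span_le.2 (by rintro _ ⟨i, z, hi, rfl⟩; exact h i z hi)

/-- A functional that vanishes on the radical but not at `e v • x`, rescaled to be `1` there,
defines the map. -/
theorem exists_toSimple {X : Type*} [AddCommGroup X] [Module B X] [Module K X]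
    [IsScalarTower K B X] {v : V} {x : X} (hx : D.e v • x ∉ D.radPart X Set.univ) :
    ∃ g : X →ₗ[B] D.Simple v, g x = D.gen v := by
  obtain ⟨l, hlx, hl⟩ := Submodule.exists_le_ker_of_notMem hx
  refine ⟨D.toSimple v ((l (D.e v • x))⁻¹ • l) (fun i z => ?_), ?_⟩
  · have : l (D.a i • z) = 0 := hl (D.a_smul_mem_radPart (Set.mem_univ _) z)
    rw [LinearMap.smul_apply, this, smul_zero]
  · rw [toSimple_apply, LinearMap.smul_apply, smul_eq_mul, inv_mul_cancel₀ hlx, one_smul]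

variable [Fintype V]

/-- The kernel of a projective cover is contained in the radical. -/
theorem ker_cover_le {P M : Type*} [AddCommGroup P] [Module B P] [AddCommGroup M] [Module B M]
    [Module K P] [IsScalarTower K B P] {f : P →ₗ[B] M} (hf : IsProjectiveCover f) {x : P}
    (hx : f x = 0) : x ∈ D.radPart P Set.univ := by
  rw [← one_smul B x, ← D.sum_e, Finset.sum_smul]
  refine sum_mem fun v _ => ?_
  by_contra hv
  obtain ⟨g, hg⟩ := D.exists_toSimple hv
  -- Since `g x` spans the simple module and `x ∈ ker f`, subtracting a multiple of `x` moves any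
  -- element into `ker g`.
  have htop : LinearMap.ker g ⊔ LinearMap.ker f = ⊤ := by
    rw [eq_top_iff]
    intro y _
    obtain ⟨k, hk⟩ := D.exists_eq_smul_gen (g y)
    rw [← sub_add_cancel y (algebraMap K B k • x)]
    refine Submodule.add_mem_sup ?_ (Submodule.smul_mem _ _ hx)
    rw [LinearMap.mem_ker, map_sub, map_smul, hk, hg, algebraMap_smul, sub_self]
  have : x ∈ LinearMap.ker g := hf.superfluous _ htop ▸ Submodule.mem_top
  exact D.gen_ne_zero v (hg.symm.trans this)

variable [IsArtinianRing B]

/-- A module killed by the arrows is semisimple. -/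
theorem cls_mem_closure_simple {X : Type u} [AddCommGroup X] [Module B X] [Module.Finite B X]
    [Module K X] [IsScalarTower K B X] [Module.Finite K X] {W : Set V}
    (ha : ∀ i (x : X), D.a i • x = 0) (hW : ∀ v ∉ W, ∀ x : X, D.e v • x = 0) :
    (cls X : K0 B) ∈ AddSubgroup.closure ((fun v => (cls (D.Simple v) : K0 B)) '' W) := by
  induction hn : Module.finrank K X using Nat.strong_induction_on generalizing X with
  | h n ih =>
    subst hn
    rcases subsingleton_or_nontrivial X with hX | hX
    · rw [cls_of_subsingleton]
      exact zero_mem _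
    obtain ⟨x, hx⟩ := exists_ne (0 : X)
    obtain ⟨v, hv⟩ := D.exists_e_smul_ne_zero hx
    have hrad : D.radPart X Set.univ ≤ ⊥ := D.radPart_le fun i z _ => ha i z
    obtain ⟨g, hg⟩ := D.exists_toSimple fun h => hv (hrad h)
    -- As the arrows kill `X`, the vector `e v • x` spans a copy of the simple module, and `h` is a
    -- section of `g`.
    let h : D.Simple v →ₗ[B] X := D.simpleLift (D.e v • x)
      (by rw [smul_smul, e_mul_e_self]) (fun i => ha i _)
    have hgh (y : D.Simple v) : g (h y) = y := by
      obtain ⟨k, rfl⟩ := D.exists_eq_smul_gen y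
      rw [LinearMap.map_smul_of_tower, simpleLift_gen, LinearMap.map_smul_of_tower, map_smul, hg,
        e_smul_gen_self]
    have : Module.Finite K (LinearMap.ker g) :=
      inferInstanceAs (Module.Finite K ((LinearMap.ker g).restrictScalars K))
    rw [cls_eq_add_ker g h hgh]
    refine add_mem (AddSubgroup.subset_closure ⟨v, ?_, rfl⟩) (ih _ ?_ ?_ ?_ rfl)
    · by_contra hvW
      exact hv (hW v hvW x)
    · refine Submodule.finrank_lt (s := (LinearMap.ker g).restrictScalars K) fun htop => ?_
      have : x ∈ (LinearMap.ker g).restrictScalars K := htop ▸ Submodule.mem_top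
      exact D.gen_ne_zero v (hg.symm.trans this)
    · exact fun i y => Subtype.ext (ha i y.1)
    · exact fun w hw y => Subtype.ext (hW w hw y.1)

/-- Syzygies are semisimple, and their composition factors belong to targets of arrows. -/
theorem syzygyHom_mem_closure_simple [Finite E] (x : K0 B) :
    syzygyHom B x ∈
      AddSubgroup.closure ((fun v => (cls (D.Simple v) : K0 B)) '' Set.range t) := by
  have := D.finite
  induction x using K0_induction with
  | zero => rw [map_zero]; exact zero_mem _
  | neg x hx => rw [map_neg]; exact neg_mem hx
  | add x y hx hy => rw [map_add]; exact add_mem hx hy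
  | cls M =>
    rw [syzygyHom_cls]
    let : Module K (coverObj M) := Module.compHom _ (algebraMap K B)
    have : IsScalarTower K B (coverObj M) := ⟨fun k b x => by
      rw [Algebra.smul_def, mul_smul]; rfl⟩
    have hle (x : LinearMap.ker (coverMap M)) : x.1 ∈ D.radPart (coverObj M) Set.univ :=
      D.ker_cover_le (coverMap_isProjectiveCover M) x.2
    have : Module.Finite K (coverObj M) := Module.Finite.trans B _
    have : Module.Finite K (LinearMap.ker (coverMap M)) := Module.Finite.trans B _
    -- The kernel lies in the radical, which is spanned by the elements `a j • z`: arrows kill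
    -- these, and so does every idempotent at a vertex that is no target.
    refine D.cls_mem_closure_simple (X := LinearMap.ker (coverMap M)) (fun i x => Subtype.ext ?_)
      (fun v hv x => Subtype.ext ?_)
    · refine D.radPart_le (p := LinearMap.ker (Algebra.lsmul K K (coverObj M) (D.a i)))
        (fun j z _ => ?_) (hle x)
      simp [smul_smul, a_mul_a]
    · refine D.radPart_le (p := LinearMap.ker (Algebra.lsmul K K (coverObj M) (D.e v)))
        (fun j z _ => ?_) (hle x)
      simp [smul_smul, D.e_mul_a (fun h => hv ⟨j, h.symm⟩)]

end Syzygies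

/-! ### The multiplicity of a simple summand as an invariant on `K₀`. -/

section Invariant

variable {K : Type*} {B : Type u} {V E : Type*} [Field K] [Ring B] [Algebra K B] {s t : E → V}
  (D : RadSqZeroBasis K B s t)

/-- The elements at a vertex that are killed by the arrows. -/
noncomputable def socPart (X : Type*) [AddCommGroup X] [Module B X] [Module K X]
    [IsScalarTower K B X] (v : V) : Submodule K X where
  carrier := {x | D.e v • x = x ∧ ∀ i, D.a i • x = 0}
  add_mem' := by
    rintro x y ⟨hx, hx'⟩ ⟨hy, hy'⟩
    exact ⟨by rw [smul_add, hx, hy], fun i => by rw [smul_add, hx', hy', add_zero]⟩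
  zero_mem' := ⟨smul_zero _, fun _ => smul_zero _⟩
  smul_mem' := by
    rintro k x ⟨hx, hx'⟩
    exact ⟨by rw [smul_comm, hx], fun i => by rw [smul_comm, hx', smul_zero]⟩

/-- The difference of the dimension of `socPart` and of its subspace `radPart`. -/
noncomputable def mult (v : V) (X : Type*) [AddCommGroup X] [Module B X] [Module K X]
    [IsScalarTower K B X] : ℤ :=
  Module.finrank K (D.socPart X v) - Module.finrank K (D.radPart X {v})

section

variable {X Y Z : Type*} [AddCommGroup X] [Module B X] [Module K X] [IsScalarTower K B X]
  [AddCommGroup Y] [Module B Y] [Module K Y] [IsScalarTower K B Y]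
  [AddCommGroup Z] [Module B Z] [Module K Z] [IsScalarTower K B Z]

theorem mem_socPart {v : V} {x : X} :
    x ∈ D.socPart X v ↔ D.e v • x = x ∧ ∀ i, D.a i • x = 0 := Iff.rfl

theorem map_mem_socPart (f : X →ₗ[B] Y) {v : V} {x : X} (hx : x ∈ D.socPart X v) :
    f x ∈ D.socPart Y v :=
  ⟨by rw [← map_smul, hx.1], fun i => by rw [← map_smul, hx.2, map_zero]⟩

theorem map_mem_radPart (f : X →ₗ[B] Y) {W : Set V} {x : X} (hx : x ∈ D.radPart X W) :
    f x ∈ D.radPart Y W := by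
  refine D.radPart_le (p := (D.radPart Y W).comap (f.restrictScalars K)) (fun i z hi => ?_) hx
  simpa using D.a_smul_mem_radPart hi (f z)

theorem radPart_le_socPart (v : V) : D.radPart X {v} ≤ D.socPart X v := by
  refine D.radPart_le fun i z hi => ⟨?_, fun j => ?_⟩
  · rw [← Set.mem_singleton_iff.1 hi, smul_smul, e_mul_a_self]
  · rw [smul_smul, a_mul_a, zero_smul]

theorem mult_eq_zero {v : V} (h : D.socPart X v ≤ D.radPart X {v}) : D.mult v X = 0 := by
  rw [mult, le_antisymm h (D.radPart_le_socPart v), sub_self]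

theorem mult_congr (v : V) (f : X ≃ₗ[B] Y) : D.mult v X = D.mult v Y := by
  have h1 : (D.socPart X v).map (f.restrictScalars K).toLinearMap = D.socPart Y v := by
    ext y
    exact ⟨by rintro ⟨x, hx, rfl⟩; exact D.map_mem_socPart f.toLinearMap hx,
      fun hy => ⟨f.symm y, D.map_mem_socPart f.symm.toLinearMap hy, f.apply_symm_apply y⟩⟩
  have h2 : (D.radPart X {v}).map (f.restrictScalars K).toLinearMap = D.radPart Y {v} := by
    ext y
    exact ⟨by rintro ⟨x, hx, rfl⟩; exact D.map_mem_radPart f.toLinearMap hx,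
      fun hy => ⟨f.symm y, D.map_mem_radPart f.symm.toLinearMap hy, f.apply_symm_apply y⟩⟩
  rw [mult, mult, ← h1, ← h2, LinearEquiv.finrank_map_eq, LinearEquiv.finrank_map_eq]

theorem finrank_submodule_prod [Module.Finite K X] [Module.Finite K Y] (p : Submodule K X)
    (q : Submodule K Y) :
    Module.finrank K (p.prod q) = Module.finrank K p + Module.finrank K q := by
  rw [← Module.finrank_prod]
  exact LinearEquiv.finrank_eq
    { toFun := fun z => (⟨z.1.1, z.2.1⟩, ⟨z.1.2, z.2.2⟩)
      map_add' := fun _ _ => rfl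
      map_smul' := fun _ _ => rfl
      invFun := fun z => ⟨(z.1.1, z.2.1), z.1.2, z.2.2⟩
      left_inv := fun _ => rfl
      right_inv := fun _ => rfl }

theorem mult_prod [Module.Finite K X] [Module.Finite K Y] (v : V) :
    D.mult v (X × Y) = D.mult v X + D.mult v Y := by
  have h1 : D.socPart (X × Y) v = (D.socPart X v).prod (D.socPart Y v) := by
    ext ⟨x, y⟩
    simp only [mem_socPart, Submodule.mem_prod, Prod.smul_mk, Prod.mk.injEq, Prod.mk_eq_zero,
      forall_and]
    tauto
  have h2 : D.radPart (X × Y) {v} = (D.radPart X {v}).prod (D.radPart Y {v}) := by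
    ext ⟨x, y⟩
    refine ⟨fun h => ⟨D.map_mem_radPart (LinearMap.fst B X Y) h,
      D.map_mem_radPart (LinearMap.snd B X Y) h⟩, fun h => ?_⟩
    have := add_mem (D.map_mem_radPart (LinearMap.inl B X Y) h.1)
      (D.map_mem_radPart (LinearMap.inr B X Y) h.2)
    simpa using this
  rw [mult, mult, mult, h1, h2, finrank_submodule_prod, finrank_submodule_prod]
  push_cast
  ring

end

theorem e_mul_sub_mem_radPart (v : V) (b : B) :
    D.e v * b - D.vc v b • D.e v ∈ D.radPart B {v} := by
  refine D.span_induction (p := (D.radPart B {v}).comap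
    (LinearMap.mulLeft K (D.e v) - (D.vc v).smulRight (D.e v))) (fun w => ?_) (fun i => ?_) b
  · by_cases hw : v = w
    · subst hw
      simp [e_mul_e_self, vc_e_self]
    · simp [D.e_mul_e hw, D.vc_e hw]
  · by_cases hi : v = t i
    · have := D.a_smul_mem_radPart (X := B) (W := {v}) (i := i) hi.symm 1
      subst hi
      simpa [e_mul_a_self, vc_a] using this
    · simp [D.e_mul_a hi, D.vc_a]

/-- An arrow `i` starting at `v` detects the coordinate at `e v`, because `a i * b = vc v b • a i`.
An element of the socle at `v` therefore has no `e v` component. -/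
theorem socPart_le_radPart {v : V} (hv : v ∈ Set.range s) :
    D.socPart B v ≤ D.radPart B {v} := by
  obtain ⟨i, rfl⟩ := hv
  rintro b ⟨hb, hb'⟩
  have h := hb' i
  rw [smul_eq_mul, a_mul, smul_eq_zero, or_iff_left (D.a_ne_zero i)] at h
  rw [smul_eq_mul] at hb
  simpa [h, hb] using D.e_mul_sub_mem_radPart (s i) b

theorem mult_projective {v : V} (hv : v ∈ Set.range s) (P : Type*) [AddCommGroup P] [Module B P]
    [Module K P] [IsScalarTower K B P] (hP : Module.Projective B P) : D.mult v P = 0 := by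
  refine D.mult_eq_zero fun p hp => ?_
  obtain ⟨σ, hσ⟩ := hP.out
  rw [← hσ p, Finsupp.linearCombination_apply, Finsupp.sum]
  refine sum_mem fun k _ => ?_
  -- The section `σ` into a free module preserves the socle, so each coefficient of `p` lies in the
  -- radical of `B`; mapping `1` to `k` carries it into the radical of `P`.
  have h1 : σ p k ∈ D.radPart B {v} :=
    D.socPart_le_radPart hv (D.map_mem_socPart ((Finsupp.lapply k).comp σ) hp)
  exact D.map_mem_radPart (LinearMap.toSpanSingleton B P k) h1

theorem radPart_simple (v : V) (W : Set V) : D.radPart (D.Simple v) W = ⊥ :=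
  eq_bot_iff.2 (D.radPart_le fun i z _ => D.a_smul_simple i z)

theorem finrank_simple (v : V) : Module.finrank K (D.Simple v) = 1 :=
  finrank_eq_one (D.gen v) (D.gen_ne_zero v) fun y => by
    obtain ⟨k, hk⟩ := D.exists_eq_smul_gen y
    exact ⟨k, hk.symm⟩

theorem mult_simple_self (v : V) : D.mult v (D.Simple v) = 1 := by
  have h : D.socPart (D.Simple v) v = ⊤ := by
    rw [eq_top_iff]
    intro y _
    obtain ⟨k, rfl⟩ := D.exists_eq_smul_gen y
    exact Submodule.smul_mem _ _ ⟨D.e_smul_gen_self v, (D.a_smul_gen · v)⟩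
  rw [mult, h, radPart_simple, finrank_top, finrank_simple, finrank_bot]
  rfl

theorem mult_simple {v w : V} (h : v ≠ w) : D.mult v (D.Simple w) = 0 := by
  refine D.mult_eq_zero fun y hy => ?_
  obtain ⟨k, rfl⟩ := D.exists_eq_smul_gen y
  rw [← hy.1, smul_comm, D.e_smul_gen h, smul_zero]
  exact zero_mem _

/-- The arrow `i` still acts nontrivially on the generator of the quotient, so socle elements have
no component along the generator and lie in the radical. -/
theorem mult_projQuot {v : V} {I : Set E} {i : E} (hi : i ∉ I) (hs : s i = v) :
    D.mult v (D.projQuot v I) = 0 := by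
  refine D.mult_eq_zero fun y hy => ?_
  obtain ⟨⟨b, hb⟩, rfl⟩ := Submodule.mkQ_surjective _ y
  have h1 : D.a i * b ∈ D.arrowSpan I := by
    have := hy.2 i
    rw [← map_smul, Submodule.mkQ_apply, Submodule.Quotient.mk_eq_zero] at this
    exact this
  have h2 : D.vc v b = 0 := by
    have := D.ac_of_mem_arrowSpan h1 hi
    rwa [a_mul, map_smul, ac_a_self, smul_eq_mul, mul_one, hs] at this
  have h3 : D.e v * b ∈ (D.radPart (D.proj v) {v}).map
      ((D.proj v).subtype.restrictScalars K) := by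
    refine D.arrowSpan_le_of_arrows (p := ((D.radPart (D.proj v) {v}).map
      ((D.proj v).subtype.restrictScalars K)).comap (LinearMap.mulLeft K (D.e v)))
      (fun j hj => ?_) (D.mem_arrowSpan_of_mem_proj hb h2)
    rw [Submodule.mem_comap, LinearMap.mulLeft_apply]
    by_cases ht : v = t j
    · refine ⟨D.a j • ⟨D.e v, D.e_mem_proj v⟩, D.a_smul_mem_radPart ht.symm _, ?_⟩
      change D.a j * D.e v = D.e v * D.a j
      have hj' : s j = v := hj
      conv_lhs => rw [← hj', a_mul_e_self]
      rw [ht, e_mul_a_self]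
    · rw [D.e_mul_a ht]
      exact zero_mem _
  obtain ⟨c, hc, hcb⟩ := h3
  rw [← hy.1, ← map_smul]
  have : D.e v • (⟨b, hb⟩ : D.proj v) = c := Subtype.ext hcb.symm
  rw [this]
  exact D.map_mem_radPart _ hc

variable [Finite V] [Finite E]

/-- The homomorphism on `K₀` induced by `mult`. -/
noncomputable def multHom {v : V} (hv : v ∈ Set.range s) : K0 B →+ ℤ :=
  K0.liftHom
    (fun M =>
      letI : Module K M := Module.compHom M (algebraMap K B)
      haveI : IsScalarTower K B M := ⟨fun k b x => by rw [Algebra.smul_def, mul_smul]; rfl⟩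
      D.mult v M)
    (fun M M' M'' ⟨f⟩ => by
      have := D.finite
      let _ : Module K M := Module.compHom M (algebraMap K B)
      have : IsScalarTower K B M := ⟨fun k b x => by rw [Algebra.smul_def, mul_smul]; rfl⟩
      let _ : Module K M' := Module.compHom M' (algebraMap K B)
      have : IsScalarTower K B M' := ⟨fun k b x => by rw [Algebra.smul_def, mul_smul]; rfl⟩
      let _ : Module K M'' := Module.compHom M'' (algebraMap K B)
      have : IsScalarTower K B M'' := ⟨fun k b x => by rw [Algebra.smul_def, mul_smul]; rfl⟩
      have : Module.Finite K M' := Module.Finite.trans B _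
      have : Module.Finite K M'' := Module.Finite.trans B _
      exact (D.mult_congr v f).trans (D.mult_prod v))
    (fun P hP => by
      let _ : Module K P := Module.compHom P (algebraMap K B)
      have : IsScalarTower K B P := ⟨fun k b x => by rw [Algebra.smul_def, mul_smul]; rfl⟩
      exact D.mult_projective hv P hP)

theorem multHom_cls {v : V} (hv : v ∈ Set.range s) (X : Type u) [AddCommGroup X] [Module B X]
    [Module.Finite B X] [inst : Module K X] [IsScalarTower K B X] :
    D.multHom hv (cls X) = D.mult v X := by
  -- The scalar tower forces the `K`-structure, so it is the one used to define `multHom`.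
  have h : inst = Module.compHom X (algebraMap K B) :=
    Module.ext' _ _ fun k x => (algebraMap_smul B k x).symm
  subst h
  exact K0.liftHom_cls _ _ _ X

theorem multHom_cls_simple [DecidableEq V] {v : V} (hv : v ∈ Set.range s) (w : V) :
    D.multHom hv (cls (D.Simple w)) = if w = v then 1 else 0 := by
  rw [multHom_cls]
  split_ifs with h
  · subst h
    exact D.mult_simple_self w
  · exact D.mult_simple (Ne.symm h)

end Invariant

end RadSqZeroBasis

/-! ### Kernels of powers of an integer matrix and of its transpose. -/

section IntegerMatrix

variable {W : Type*} [Fintype W]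

/-- A rational vector becomes integral after clearing denominators. This gives access to rank over a
field. -/
theorem ker_mulVecLin_map_intCast_le_iff (A C : Matrix W W ℤ) :
    LinearMap.ker (A.map (Int.cast : ℤ → ℚ)).mulVecLin ≤
        LinearMap.ker (C.map (Int.cast : ℤ → ℚ)).mulVecLin ↔
      ∀ c : W → ℤ, A.mulVec c = 0 → C.mulVec c = 0 := by
  have hcast (M : Matrix W W ℤ) (c : W → ℤ) :
      (M.map (Int.cast : ℤ → ℚ)).mulVec (fun w => (c w : ℚ)) = fun w => (M.mulVec c w : ℚ) := by
    ext w
    simp [Matrix.mulVec, dotProduct]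
  have hzero (M : Matrix W W ℤ) (c : W → ℤ) :
      (M.map (Int.cast : ℤ → ℚ)).mulVec (fun w => (c w : ℚ)) = 0 ↔ M.mulVec c = 0 := by
    rw [hcast]
    simp [funext_iff]
  constructor
  · intro h c hc
    exact (hzero C c).1 (h (x := fun w => (c w : ℚ)) ((hzero A c).2 hc))
  · intro h x hx
    obtain ⟨b, hb⟩ := IsLocalization.exist_integer_multiples_of_finite (nonZeroDivisors ℤ) x
    choose c hc using hb
    have hb0 : ((b : ℤ) : ℚ) ≠ 0 := by simp
    have hx' : (fun w => (c w : ℚ)) = ((b : ℤ) : ℚ) • x := by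
      ext w
      simpa [Algebra.smul_def] using hc w
    rw [LinearMap.mem_ker, Matrix.mulVecLin_apply] at hx ⊢
    have h1 := (hzero C c).2 (h c ((hzero A c).1 (by rw [hx', Matrix.mulVec_smul, hx, smul_zero])))
    rw [hx', Matrix.mulVec_smul] at h1
    exact (smul_eq_zero.1 h1).resolve_left hb0

variable [DecidableEq W]

/-- One inclusion of kernels always holds, so by rank-nullity the other amounts to equal ranks. -/
theorem forall_mulVec_pow_iff_rank_eq (N : Matrix W W ℤ) (k : ℕ) :
    (∀ c : W → ℤ, (N ^ (k + 1)).mulVec c = 0 → (N ^ k).mulVec c = 0) ↔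
      ((N ^ (k + 1)).map (Int.cast : ℤ → ℚ)).rank = ((N ^ k).map (Int.cast : ℤ → ℚ)).rank := by
  rw [← ker_mulVecLin_map_intCast_le_iff]
  have hle : LinearMap.ker ((N ^ k).map (Int.cast : ℤ → ℚ)).mulVecLin ≤
      LinearMap.ker ((N ^ (k + 1)).map (Int.cast : ℤ → ℚ)).mulVecLin := by
    rw [ker_mulVecLin_map_intCast_le_iff]
    intro c hc
    rw [pow_succ', ← Matrix.mulVec_mulVec, hc, Matrix.mulVec_zero]
  have h1 := LinearMap.finrank_range_add_finrank_ker
    ((N ^ k).map (Int.cast : ℤ → ℚ)).mulVecLin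
  have h2 := LinearMap.finrank_range_add_finrank_ker
    ((N ^ (k + 1)).map (Int.cast : ℤ → ℚ)).mulVecLin
  constructor
  · intro h
    rw [Matrix.rank, Matrix.rank]
    rw [le_antisymm h hle] at h2
    omega
  · intro h
    rw [Matrix.rank, Matrix.rank] at h
    exact (Submodule.eq_of_le_of_finrank_eq hle (by omega)).ge

theorem forall_mulVec_pow_iff_forall_vecMul_pow (N : Matrix W W ℤ) (k : ℕ) :
    (∀ c : W → ℤ, (N ^ (k + 1)).mulVec c = 0 → (N ^ k).mulVec c = 0) ↔
      ∀ c : W → ℤ, Matrix.vecMul c (N ^ (k + 1)) = 0 → Matrix.vecMul c (N ^ k) = 0 := by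
  simp_rw [← Matrix.mulVec_transpose, Matrix.transpose_pow]
  rw [forall_mulVec_pow_iff_rank_eq, forall_mulVec_pow_iff_rank_eq, ← Matrix.transpose_pow,
    ← Matrix.transpose_pow, Matrix.transpose_map, Matrix.transpose_map, Matrix.rank_transpose,
    Matrix.rank_transpose]

end IntegerMatrix

open Classical in
/-- The number of arrows between the vertices of a set. -/
noncomputable def arrowMatrix {V E : Type*} [Fintype E] (W : Set V) (s t : E → V) :
    Matrix W W ℤ :=
  fun v w => (Finset.univ.filter fun i => s i = v ∧ t i = w).card

theorem arrowMatrix_swap {V E : Type*} [Fintype E] (W : Set V) (s t : E → V) :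
    arrowMatrix W t s = (arrowMatrix W s t).transpose := by
  ext v w
  simp only [arrowMatrix, Matrix.transpose_apply]
  congr! 3
  exact and_comm

namespace RadSqZeroBasis

/-! ### The action of `Ω̄` on its image, and the positive exponents. -/

section Stable

variable {K : Type*} {B : Type u} {V E : Type*} [Field K] [Ring B] [Algebra K B] {s t : E → V}
  (D : RadSqZeroBasis K B s t) (W : Set V) [Fintype W]

/-- Integer combinations of the classes of the simple modules that belong to a set of vertices. -/
noncomputable def simpleComb (c : W → ℤ) : K0 B := ∑ w, c w • cls (D.Simple (w : V))

theorem simpleComb_single [DecidableEq W] (w : W) :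
    D.simpleComb W (Pi.single w 1) = cls (D.Simple (w : V)) := by
  rw [simpleComb, Finset.sum_eq_single w]
  · simp
  · intro v _ hv
    simp [hv]
  · simp

theorem simpleComb_add (c d : W → ℤ) :
    D.simpleComb W (c + d) = D.simpleComb W c + D.simpleComb W d := by
  simp [simpleComb, add_smul, Finset.sum_add_distrib]

theorem simpleComb_neg (c : W → ℤ) :
    D.simpleComb W (-c) = - D.simpleComb W c := by
  simp [simpleComb]

theorem simpleComb_zero : D.simpleComb W 0 = 0 := by
  simp [simpleComb]

variable {W}

theorem exists_simpleComb_of_mem_closure {x : K0 B}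
    (hx : x ∈ AddSubgroup.closure ((fun v => (cls (D.Simple v) : K0 B)) '' W)) :
    ∃ c, D.simpleComb W c = x := by
  classical
  induction hx using AddSubgroup.closure_induction with
  | mem x hx =>
    obtain ⟨v, hv, rfl⟩ := hx
    exact ⟨_, D.simpleComb_single W ⟨v, hv⟩⟩
  | zero => exact ⟨0, D.simpleComb_zero W⟩
  | add x y _ _ hx hy =>
    obtain ⟨c, rfl⟩ := hx
    obtain ⟨d, rfl⟩ := hy
    exact ⟨c + d, D.simpleComb_add W c d⟩
  | neg x _ hx =>
    obtain ⟨c, rfl⟩ := hx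
    exact ⟨-c, D.simpleComb_neg W c⟩

/-- The homomorphisms `multHom` form a dual family to these simple classes. -/
theorem simpleComb_eq_zero_iff [Finite V] [Finite E] (hW : W ⊆ Set.range s) (c : W → ℤ) :
    D.simpleComb W c = 0 ↔ c = 0 := by
  classical
  refine ⟨fun h => ?_, fun h => h ▸ D.simpleComb_zero W⟩
  ext w
  have := congrArg (D.multHom (hW w.2)) h
  rw [simpleComb, map_sum, map_zero] at this
  simpa [multHom_cls_simple, Subtype.val_inj] using this

variable [IsArtinianRing B]

theorem syzygyHom_simpleComb [Fintype E] (hW : W = Set.range s ∩ Set.range t) (c : W → ℤ) :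
    syzygyHom B (D.simpleComb W c) = D.simpleComb W (Matrix.vecMul c (arrowMatrix W s t)) := by
  classical
  have h (v : W) : syzygyHom B (cls (D.Simple (v : V))) =
      ∑ w : W, arrowMatrix W s t v w • (cls (D.Simple (w : V)) : K0 B) := by
    have h1 (w : W) : arrowMatrix W s t v w • (cls (D.Simple (w : V)) : K0 B) =
        ∑ i with s i = v, if t i = w then (cls (D.Simple (t i)) : K0 B) else 0 := by
      rw [← Finset.sum_filter, Finset.filter_filter, Finset.sum_congr rfl
        (g := fun _ => (cls (D.Simple (w : V)) : K0 B)), Finset.sum_const, arrowMatrix]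
      · rw [natCast_zsmul]
      · intro i hi
        rw [(Finset.mem_filter.1 hi).2.2]
    rw [syzygyHom_cls_simple, Finset.sum_congr rfl fun w _ => h1 w, Finset.sum_comm]
    refine Finset.sum_congr rfl fun i hi => ?_
    by_cases ht : t i ∈ W
    · rw [Finset.sum_eq_single ⟨t i, ht⟩]
      · simp
      · intro w _ hw
        rw [if_neg]
        rintro h
        exact hw (Subtype.ext h.symm)
      · simp
    -- A target outside `W` is the source of no arrow, so its simple module is projective.
    · have h0 : (cls (D.Simple (t i)) : K0 B) = 0 :=
        D.cls_simple_of_forall_ne fun j hj => ht (hW ▸ ⟨⟨j, hj⟩, ⟨i, rfl⟩⟩)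
      simp [h0]
  simp only [simpleComb, map_sum, map_zsmul, h, Finset.smul_sum, Matrix.vecMul, dotProduct,
    Finset.sum_smul, smul_smul]
  exact Finset.sum_comm

theorem syzygyHom_pow_simpleComb [Fintype E] (hW : W = Set.range s ∩ Set.range t) [DecidableEq W]
    (k : ℕ) (c : W → ℤ) : (syzygyHom B ^ k) (D.simpleComb W c) =
      D.simpleComb W (Matrix.vecMul c (arrowMatrix W s t ^ k)) := by
  induction k generalizing c with
  | zero => rw [pow_zero, pow_zero, Matrix.vecMul_one]; rfl
  | succ k ih =>
    rw [syzygyHom_pow_succ_apply', D.syzygyHom_simpleComb hW, ih, Matrix.vecMul_vecMul, pow_succ']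

theorem exists_simpleComb_eq_syzygyHom [Fintype V] [Finite E] (hW : W = Set.range s ∩ Set.range t)
    (x : K0 B) : ∃ c, D.simpleComb W c = syzygyHom B x := by
  refine D.exists_simpleComb_of_mem_closure
    ((AddSubgroup.closure_le _).2 ?_ (D.syzygyHom_mem_closure_simple x))
  rintro _ ⟨v, hv, rfl⟩
  by_cases hs : v ∈ Set.range s
  · exact AddSubgroup.subset_closure ⟨v, hW ▸ ⟨hs, hv⟩, rfl⟩
  · rw [SetLike.mem_coe]
    beta_reduce
    rw [D.cls_simple_of_forall_ne fun i hi => hs ⟨i, hi⟩]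
    exact zero_mem _

theorem exists_syzygyHom_eq_simpleComb (hW : W = Set.range s ∩ Set.range t)
    (c : W → ℤ) : ∃ x, syzygyHom B x = D.simpleComb W c := by
  have h (w : W) : ∃ x : K0 B, syzygyHom B x = cls (D.Simple (w : V)) := by
    obtain ⟨i, hi⟩ := (hW ▸ w.2 : (w : V) ∈ Set.range s ∩ Set.range t).2
    -- Killing a single arrow that ends at `w` yields a module whose syzygy is the simple module at
    -- `w`.
    refine ⟨cls (D.projQuot (s i) {i}), ?_⟩
    rw [syzygyHom_cls_projQuot _ (by simp), cls_arrowSpan_singleton, hi]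
  choose x hx using h
  classical
  refine ⟨∑ w, c w • x w, ?_⟩
  simp [simpleComb, hx]

-- The image of `Ω̄` is exactly the group of combinations of simples in `W`, so one application of
-- `Ω̄` is used up in reaching it; this is the shift from `k + 1` to `k`.
include D in
theorem syzygyStable_succ_iff [Fintype V] [Fintype E] (hW : W = Set.range s ∩ Set.range t)
    [DecidableEq W] (k : ℕ) :
    SyzygyStable B (k + 1) ↔ ∀ c : W → ℤ, Matrix.vecMul c (arrowMatrix W s t ^ (k + 1)) = 0 →
      Matrix.vecMul c (arrowMatrix W s t ^ k) = 0 := by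
  have hWs : W ⊆ Set.range s := hW ▸ Set.inter_subset_left
  have h (k : ℕ) (c : W → ℤ) : (syzygyHom B ^ k) (D.simpleComb W c) = 0 ↔
      Matrix.vecMul c (arrowMatrix W s t ^ k) = 0 := by
    rw [D.syzygyHom_pow_simpleComb hW, D.simpleComb_eq_zero_iff hWs]
  constructor
  · intro hst c hc
    obtain ⟨x, hx⟩ := D.exists_syzygyHom_eq_simpleComb hW c
    rw [← h, ← hx, ← syzygyHom_pow_succ_apply']
    apply hst
    rw [syzygyHom_pow_succ_apply', hx, h]
    exact hc
  · intro hst x hx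
    obtain ⟨c, hc⟩ := D.exists_simpleComb_eq_syzygyHom hW x
    rw [syzygyHom_pow_succ_apply', ← hc, h] at hx ⊢
    exact hst c hx

end Stable

/-! ### Exponent zero: when `Ω̄` is injective. -/

section SelfInjective

variable {K : Type*} {B : Type u} {V E : Type*} [Field K] [Ring B] [Algebra K B] {s t : E → V}
  (D : RadSqZeroBasis K B s t)

/-- If arrows are determined by their source and by their target, a functional on a module gives
a map to the indecomposable projective module at the source of an arrow. -/
noncomputable def toProj (hs : Function.Injective s) (ht : Function.Injective t) (i : E)
    {X : Type*} [AddCommGroup X] [Module B X] [Module K X] [IsScalarTower K B X]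
    (l : X →ₗ[K] K) : X →ₗ[B] D.proj (s i) :=
  D.homOfBasis
    ((l ∘ₗ Algebra.lsmul K K X (D.a i)).smulRight (⟨D.e (s i), D.e_mem_proj _⟩ : D.proj (s i)) +
      (l ∘ₗ Algebra.lsmul K K X (D.e (t i))).smulRight (⟨D.a i, D.a_mul_e_self i⟩ : D.proj (s i)))
    (fun v x => Subtype.ext <| by
      simp only [LinearMap.add_apply, LinearMap.smulRight_apply, LinearMap.comp_apply,
        Algebra.lsmul_coe, Submodule.coe_add, Submodule.coe_smul_of_tower, smul_eq_mul, mul_add,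
        mul_smul_comm, smul_smul]
      congr 1
      · by_cases h : v = s i
        · rw [h, a_mul_e_self, e_mul_e_self]
        · rw [D.a_mul_e h, D.e_mul_e h]
          simp
      · by_cases h : v = t i
        · rw [h, e_mul_e_self, e_mul_a_self]
        · rw [D.e_mul_e (Ne.symm h), D.e_mul_a h]
          simp)
    (fun j x => Subtype.ext <| by
      simp only [LinearMap.add_apply, LinearMap.smulRight_apply, LinearMap.comp_apply,
        Algebra.lsmul_coe, Submodule.coe_add, Submodule.coe_smul_of_tower, smul_eq_mul, mul_add,
        mul_smul_comm, smul_smul, a_mul_a, zero_smul, map_zero, smul_zero, zero_add, add_zero]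
      by_cases h : i = j
      · rw [← h, e_mul_a_self, a_mul_e_self]
      · rw [D.e_mul_a (fun h' => h (ht h')), D.a_mul_e (fun h' => h (hs h'))]
        simp)

theorem toProj_apply (hs : Function.Injective s) (ht : Function.Injective t) (i : E)
    {X : Type*} [AddCommGroup X] [Module B X] [Module K X] [IsScalarTower K B X]
    (l : X →ₗ[K] K) (x : X) : (D.toProj hs ht i l x : B) =
      l (D.a i • x) • D.e (s i) + l (D.e (t i) • x) • D.a i := rfl

theorem toProj_surjective (hs : Function.Injective s) (ht : Function.Injective t) (i : E)
    {X : Type*} [AddCommGroup X] [Module B X] [Module K X] [IsScalarTower K B X]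
    (l : X →ₗ[K] K) {x : X} (hx : l (D.a i • x) = 1) :
    Function.Surjective (D.toProj hs ht i l) := by
  rintro ⟨b, hb⟩
  -- The map sends `x` to `e (s i) + l (e (t i) • x) • a i` and `a i • x` to `a i`, so the corrected
  -- vector goes to the generator `e (s i)`.
  refine ⟨b • (x - (l (D.e (t i) • x)) • D.a i • x), Subtype.ext ?_⟩
  have h1 : D.e (t i) • D.a i • x = D.a i • x := by rw [smul_smul, e_mul_a_self]
  have h2 : D.a i • D.a i • x = 0 := by rw [smul_smul, a_mul_a, zero_smul]
  rw [map_smul, map_sub, LinearMap.map_smul_of_tower, Submodule.coe_smul, Submodule.coe_sub,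
    Submodule.coe_smul_of_tower, toProj_apply, toProj_apply, h1, h2, hx, map_zero, zero_smul,
    one_smul, one_smul, zero_add, add_sub_cancel_right]
  exact hb

variable [IsArtinianRing B]

/-- If some arrow acts nontrivially, `toProj` splits off a projective summand, which does not change
the class; induction on dimension ends with a semisimple module. -/
theorem cls_mem_closure_simple_of_injective [Fintype V] (hs : Function.Injective s)
    (ht : Function.Injective t) {X : Type u} [AddCommGroup X] [Module B X] [Module.Finite B X]
    [Module K X] [IsScalarTower K B X] [Module.Finite K X] :
    (cls X : K0 B) ∈
      AddSubgroup.closure ((fun v => (cls (D.Simple v) : K0 B)) '' Set.univ) := by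
  induction hn : Module.finrank K X using Nat.strong_induction_on generalizing X with
  | h n ih =>
    subst hn
    by_cases h : ∀ i (x : X), D.a i • x = 0
    · exact D.cls_mem_closure_simple h fun v hv => absurd (Set.mem_univ v) hv
    push Not at h
    obtain ⟨i, x, hx⟩ := h
    obtain ⟨l, hl, -⟩ := Submodule.exists_le_ker_of_notMem (p := (⊥ : Submodule K X)) hx
    have hl' : ((l (D.a i • x))⁻¹ • l) (D.a i • x) = 1 := by
      rw [LinearMap.smul_apply, smul_eq_mul, inv_mul_cancel₀ hl]
    let f := D.toProj hs ht i ((l (D.a i • x))⁻¹ • l)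
    have hf : Function.Surjective f := D.toProj_surjective hs ht i _ hl'
    have : Module.Finite K (LinearMap.ker f) :=
      inferInstanceAs (Module.Finite K ((LinearMap.ker f).restrictScalars K))
    rw [cls_eq_ker_of_projective (D.projective_proj (s i)) f hf]
    refine ih _ ?_ rfl
    refine Submodule.finrank_lt (s := (LinearMap.ker f).restrictScalars K) fun htop => ?_
    obtain ⟨y, hy⟩ := hf ⟨D.e (s i), D.e_mem_proj _⟩
    have h0 : y ∈ (LinearMap.ker f).restrictScalars K := htop ▸ Submodule.mem_top
    have := congrArg Subtype.val (hy.symm.trans h0)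
    exact D.basis.ne_zero _ this

-- `K₀` is now generated by simples, and `Ω̄` takes the simple at `s i` to the one at `t i`.
-- Distinct arrows give distinct targets, whose simples are nonprojective and hence independent;
-- simples at non-sources are zero.
include D in
theorem syzygyStable_zero_of_injective [Fintype V] [Finite E] (hs : Function.Injective s)
    (ht : Function.Injective t) (hst : Set.range t ⊆ Set.range s) : SyzygyStable B 0 := by
  classical
  have := Fintype.ofFinite E
  have := D.finite
  have hcl (x : K0 B) :
      x ∈ AddSubgroup.closure ((fun v => (cls (D.Simple v) : K0 B)) '' Set.univ) := by
    induction x using K0_induction with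
    | zero => exact zero_mem _
    | neg x hx => exact neg_mem hx
    | add x y hx hy => exact add_mem hx hy
    | cls M =>
      let _ : Module K M := Module.compHom M (algebraMap K B)
      have : IsScalarTower K B M := ⟨fun k b x => by rw [Algebra.smul_def, mul_smul]; rfl⟩
      have : Module.Finite K M := Module.Finite.trans B _
      exact D.cls_mem_closure_simple_of_injective hs ht
  intro x hx
  obtain ⟨c, rfl⟩ := D.exists_simpleComb_of_mem_closure (hcl x)
  replace hx : syzygyHom B (D.simpleComb Set.univ c) = 0 :=
    (syzygyHom_pow_succ_apply 0 _).symm.trans hx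
  have hc (i : E) : c ⟨s i, trivial⟩ = 0 := by
    have h1 := congrArg (D.multHom (hst ⟨i, rfl⟩)) hx
    have h2 (v : (Set.univ : Set V)) :
        D.multHom (hst ⟨i, rfl⟩) (syzygyHom B (cls (D.Simple (v : V)))) =
          if v = ⟨s i, trivial⟩ then 1 else 0 := by
      rw [syzygyHom_cls_simple, map_sum, Finset.sum_filter, Finset.sum_eq_single i]
      · simp [multHom_cls_simple, Subtype.ext_iff, eq_comm]
      · intro j _ hj
        rw [multHom_cls_simple, if_neg (fun h => hj (ht h)), ite_self]
      · simp
    rw [simpleComb, map_sum, map_sum, map_zero] at h1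
    simpa [h2] using h1
  change D.simpleComb Set.univ c = 0
  refine Finset.sum_eq_zero fun v _ => ?_
  by_cases hv : (v : V) ∈ Set.range s
  · obtain ⟨i, hi⟩ := hv
    obtain rfl : ⟨s i, trivial⟩ = v := Subtype.ext hi
    rw [hc, zero_smul]
  · rw [D.cls_simple_of_forall_ne fun i hi => hv ⟨i, hi⟩, smul_zero]

include D in
theorem injective_of_syzygyStable_zero [Finite V] [Finite E] (h : SyzygyStable B 0) :
    Function.Injective s ∧ Function.Injective t ∧ Set.range t ⊆ Set.range s := by
  classical
  have := Fintype.ofFinite E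
  have h0 (x : K0 B) (hx : syzygyHom B x = 0) : x = 0 :=
    h x ((syzygyHom_pow_succ_apply 0 x).trans hx)
  have hs : Function.Injective s := by
    intro i j hij
    by_contra hne
    have hu : {k | s k = s i} = {i} ∪ {k | s k = s i ∧ k ≠ i} := by
      ext k
      simp only [Set.mem_ofPred_eq, Set.mem_union, Set.mem_singleton_iff]
      grind
    -- Two arrows with a common source would make the syzygy of the simple there split as the
    -- syzygies of two proper quotients of its projective cover. Neither quotient has that simple as
    -- a summand, so `multHom` takes the value `1` on this kernel element.
    have h1 := h0 (cls (D.Simple (s i)) - cls (D.projQuot (s i) {i}) -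
      cls (D.projQuot (s i) {k | s k = s i ∧ k ≠ i})) <| by
        rw [map_sub, map_sub, syzygyHom_cls_projQuot _ (by simp),
          syzygyHom_cls_projQuot _ (fun k hk => hk.1), syzygyHom_cls_simple_eq_cls_arrowSpan,
          sub_sub, ← cls_arrowSpan_union _ (by simp), sub_eq_zero]
        exact cls_congr (LinearEquiv.ofEq _ _ (by rw [hu]))
    have h2 := congrArg (D.multHom (Set.mem_range_self i)) h1
    rw [map_sub, map_sub, multHom_cls_simple, multHom_cls, multHom_cls,
      D.mult_projQuot (i := j) (fun h => hne h.symm) hij.symm,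
      D.mult_projQuot (i := i) (fun h => h.2 rfl) rfl, if_pos rfl, map_zero] at h2
    exact one_ne_zero h2
  have hS (i : E) : syzygyHom B (cls (D.Simple (s i))) = cls (D.Simple (t i)) := by
    rw [syzygyHom_cls_simple, Finset.sum_filter, Finset.sum_eq_single i]
    · simp
    · intro j _ hj
      rw [if_neg fun h => hj (hs h)]
    · simp
  refine ⟨hs, fun i j hij => ?_, ?_⟩
  -- Arrows with a common target give simples with equal syzygies.
  · have h1 := h0 (cls (D.Simple (s i)) - cls (D.Simple (s j))) <| by
      rw [map_sub, hS, hS, hij, sub_self]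
    have h2 := congrArg (D.multHom (Set.mem_range_self i)) h1
    rw [map_sub, multHom_cls_simple, multHom_cls_simple, if_pos rfl, map_zero] at h2
    split_ifs at h2 with h3
    · exact hs h3.symm
    · exact absurd h2 (by norm_num)
  · rintro _ ⟨i, rfl⟩
    by_contra hi
    -- A target that is not a source has a projective simple, so the nonzero class at `s i` would be
    -- killed by `Ω̄`.
    have h1 := h0 (cls (D.Simple (s i))) <| by
      rw [hS, D.cls_simple_of_forall_ne fun j hj => hi ⟨j, hj⟩]
    have h2 := congrArg (D.multHom (Set.mem_range_self i)) h1
    rw [multHom_cls_simple, if_pos rfl, map_zero] at h2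
    exact one_ne_zero h2

end SelfInjective

/-- Reversing all arrows does not change the `φ`-dimension. -/
theorem leftModulePhiDim_eq_of_swap {K : Type*} {B B' : Type u} {V E : Type*} [Field K] [Ring B]
    [Algebra K B] [Ring B'] [Algebra K B'] {s t : E → V} [Fintype V] [Finite E]
    [IsArtinianRing B] [IsArtinianRing B'] (D : RadSqZeroBasis K B s t)
    (D' : RadSqZeroBasis K B' t s) : leftModulePhiDim B = leftModulePhiDim B' := by
  classical
  have := Fintype.ofFinite E
  refine leftModulePhiDim_congr fun k => ?_
  cases k with
  | zero =>
    -- Both ranges have as many elements as there are arrows, so the inclusion is an equality and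
    -- the criterion is symmetric.
    have hcard {s t : E → V} (hs : Function.Injective s) (ht : Function.Injective t)
        (h : Set.range t ⊆ Set.range s) : Set.range s ⊆ Set.range t := by
      refine (Set.eq_of_subset_of_ncard_le h ?_ (Set.toFinite _)).ge
      rw [Set.ncard_range_of_injective hs, Set.ncard_range_of_injective ht]
    constructor
    · intro h
      obtain ⟨hs, ht, hst⟩ := D.injective_of_syzygyStable_zero h
      exact D'.syzygyStable_zero_of_injective ht hs (hcard hs ht hst)
    · intro h
      obtain ⟨ht, hs, hst⟩ := D'.injective_of_syzygyStable_zero h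
      exact D.syzygyStable_zero_of_injective hs ht (hcard ht hs hst)
  | succ k =>
    rw [D.syzygyStable_succ_iff rfl, D'.syzygyStable_succ_iff (Set.inter_comm _ _),
      ← forall_mulVec_pow_iff_forall_vecMul_pow, arrowMatrix_swap _ s t]
    simp only [← Matrix.transpose_pow, Matrix.vecMul_transpose]

end RadSqZeroBasis

/-! ### Vertices and arrows form a basis of `K Q / J ^ 2`. -/

section PathAlgebra

variable (K : Type u) (V : Type v) [Field K] [Quiver.{w} V]

/-- The arrows of a quiver. -/
abbrev QuiverArrow : Type (max v w) := Σ a b : V, (a ⟶ b)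

/-- The span of the paths of length at least `n`. -/
noncomputable def pathFiltration (n : ℕ) : Submodule K (PathAlgebra K V) :=
  Submodule.span K {x | ∃ p : QuiverPath V, n ≤ p.path.length ∧ x = PathAlgebra.ofPath p}

variable {K V}

theorem ofPath_mem_pathFiltration {n : ℕ} {p : QuiverPath V} (h : n ≤ p.path.length) :
    PathAlgebra.ofPath p ∈ pathFiltration K V n :=
  Submodule.subset_span ⟨p, h, rfl⟩

theorem span_ofPath_induction {q : Submodule K (PathAlgebra K V)}
    (h : ∀ p, PathAlgebra.ofPath p ∈ q) (x : PathAlgebra K V) : x ∈ q := by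
  have : q.mkQ = 0 := PathAlgebra.hom_ext fun p => by simpa using h p
  simpa using LinearMap.congr_fun this x

theorem mem_pathFiltration_zero (x : PathAlgebra K V) : x ∈ pathFiltration K V 0 :=
  span_ofPath_induction (fun _ => ofPath_mem_pathFiltration (Nat.zero_le _)) x

theorem ofPath_mul_ofPath {a b c : V} (p : Quiver.Path a b) (q : Quiver.Path b c) :
    (PathAlgebra.ofPath ⟨a, b, p⟩ * PathAlgebra.ofPath ⟨b, c, q⟩ : PathAlgebra K V) =
      PathAlgebra.ofPath ⟨a, c, p.comp q⟩ :=
  (PathAlgebra.mulHom_ofPath _ _).trans (PathAlgebra.mulPath_of_eq p q)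

theorem ofPath_mul_ofPath_of_ne {p q : QuiverPath V} (h : p.tgt ≠ q.src) :
    (PathAlgebra.ofPath p * PathAlgebra.ofPath q : PathAlgebra K V) = 0 :=
  (PathAlgebra.mulHom_ofPath _ _).trans (PathAlgebra.mulPath_of_ne h)

variable [Fintype V]

theorem mul_mem_pathFiltration {m n : ℕ} {x y : PathAlgebra K V} (hx : x ∈ pathFiltration K V m)
    (hy : y ∈ pathFiltration K V n) : x * y ∈ pathFiltration K V (m + n) := by
  have h : pathFiltration K V m * pathFiltration K V n ≤ pathFiltration K V (m + n) := by
    rw [pathFiltration, pathFiltration, Submodule.span_mul_span, Submodule.span_le]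
    rintro _ ⟨_, ⟨⟨a, b, p⟩, hp, rfl⟩, _, ⟨⟨b', c, q⟩, hq, rfl⟩, rfl⟩
    by_cases hb : b = b'
    · subst hb
      beta_reduce
      rw [ofPath_mul_ofPath]
      refine ofPath_mem_pathFiltration ?_
      rw [Quiver.Path.length_comp]
      exact Nat.add_le_add hp hq
    · beta_reduce
      rw [ofPath_mul_ofPath_of_ne hb]
      exact zero_mem _
  exact h (Submodule.mul_mem_mul hx hy)

theorem mem_pathFiltration_one_of_mem_arrowIdeal {x : PathAlgebra K V}
    (hx : x ∈ arrowIdeal K V) : x ∈ pathFiltration K V 1 := by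
  let I : TwoSidedIdeal (PathAlgebra K V) := TwoSidedIdeal.mk' (pathFiltration K V 1)
    (zero_mem _) (fun h h' => add_mem h h') (fun h => neg_mem h)
    (fun {x y} h => by simpa using mul_mem_pathFiltration (mem_pathFiltration_zero x) h)
    (fun {x y} h => by simpa using mul_mem_pathFiltration h (mem_pathFiltration_zero y))
  have h : arrowIdeal K V ≤ I := by
    refine TwoSidedIdeal.span_le.2 ?_
    rintro _ ⟨a, b, e, rfl⟩
    rw [SetLike.mem_coe, TwoSidedIdeal.mem_mk']
    exact ofPath_mem_pathFiltration le_rfl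
  have := h hx
  rwa [TwoSidedIdeal.mem_mk'] at this

theorem arrowIdeal_sq :
    (arrowIdeal K V).asIdeal ^ 2 = (arrowIdeal K V).asIdeal * (arrowIdeal K V).asIdeal := by
  rw [Submodule.pow_succ, Submodule.pow_one]

/-- Path length is additive under composition, so a product of two elements of `J` involves only
paths of length at least two. This keeps vertices and arrows independent modulo `J ^ 2`. -/
theorem mem_pathFiltration_two_of_mem_sq {x : PathAlgebra K V}
    (hx : x ∈ (arrowIdeal K V).asIdeal ^ 2) : x ∈ pathFiltration K V 2 := by
  let I : Ideal (PathAlgebra K V) :=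
    { carrier := pathFiltration K V 2
      add_mem' := fun h h' => add_mem h h'
      zero_mem' := zero_mem (pathFiltration K V 2)
      smul_mem' := fun x y h => by
        simpa using mul_mem_pathFiltration (mem_pathFiltration_zero x) h }
  have h : (arrowIdeal K V).asIdeal ^ 2 ≤ I := by
    rw [arrowIdeal_sq, Ideal.mul_le]
    intro r hr s hs
    exact mul_mem_pathFiltration (m := 1) (n := 1)
      (mem_pathFiltration_one_of_mem_arrowIdeal (TwoSidedIdeal.mem_asIdeal.1 hr))
      (mem_pathFiltration_one_of_mem_arrowIdeal (TwoSidedIdeal.mem_asIdeal.1 hs))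
  exact h hx

theorem ofPath_cons_mem_arrowIdeal {a b c : V} (p : Quiver.Path a b) (e : b ⟶ c) :
    PathAlgebra.ofPath ⟨a, c, p.cons e⟩ ∈ arrowIdeal K V := by
  have h : (PathAlgebra.ofPath ⟨a, c, p.cons e⟩ : PathAlgebra K V) =
      PathAlgebra.ofPath ⟨a, b, p⟩ * PathAlgebra.ofPath ⟨b, c, e.toPath⟩ :=
    (ofPath_mul_ofPath p e.toPath).symm
  rw [h]
  exact TwoSidedIdeal.mul_mem_left _ _ _ (TwoSidedIdeal.subset_span ⟨b, c, e, rfl⟩)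

theorem ofPath_cons_cons_mem_sq {a b c d : V} (p : Quiver.Path a b) (e : b ⟶ c) (f : c ⟶ d) :
    PathAlgebra.ofPath ⟨a, d, (p.cons e).cons f⟩ ∈ (arrowIdeal K V).asIdeal ^ 2 := by
  have h : (PathAlgebra.ofPath ⟨a, d, (p.cons e).cons f⟩ : PathAlgebra K V) =
      PathAlgebra.ofPath ⟨a, c, p.cons e⟩ * PathAlgebra.ofPath ⟨c, d, f.toPath⟩ :=
    (ofPath_mul_ofPath (p.cons e) f.toPath).symm
  rw [h, arrowIdeal_sq]
  exact Ideal.mul_mem_mul (TwoSidedIdeal.mem_asIdeal.2 (ofPath_cons_mem_arrowIdeal p e))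
    (TwoSidedIdeal.mem_asIdeal.2 (TwoSidedIdeal.subset_span ⟨c, d, f, rfl⟩))

variable (K) in
omit [Fintype V] in
/-- The coordinates of a path with respect to the vertices and the arrows. -/
noncomputable def pathCoord : {a b : V} → Quiver.Path a b → (V ⊕ QuiverArrow V →₀ K)
  | a, _, .nil => Finsupp.single (.inl a) 1
  | a, b, .cons .nil e => Finsupp.single (.inr ⟨a, b, e⟩) 1
  | _, _, .cons (.cons _ _) _ => 0

variable (K V) in
omit [Fintype V] in
/-- The vertices and the arrows, as elements of the path algebra. -/
noncomputable def shortPath : V ⊕ QuiverArrow V → PathAlgebra K V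
  | .inl v => PathAlgebra.ofPath ⟨v, v, Quiver.Path.nil⟩
  | .inr i => PathAlgebra.ofPath ⟨i.1, i.2.1, i.2.2.toPath⟩

omit [Fintype V] in
theorem lift_pathCoord_shortPath (k : V ⊕ QuiverArrow V) :
    PathAlgebra.lift (fun p => pathCoord K p.path) (shortPath K V k) = Finsupp.single k 1 := by
  rcases k with v | ⟨a, b, e⟩
  · exact PathAlgebra.lift_ofPath _ _
  · exact PathAlgebra.lift_ofPath _ _

omit [Fintype V] in
theorem lift_pathCoord_eq_zero {x : PathAlgebra K V} (hx : x ∈ pathFiltration K V 2) :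
    PathAlgebra.lift (fun p => pathCoord K p.path) x = 0 := by
  have h : pathFiltration K V 2 ≤
      LinearMap.ker (PathAlgebra.lift (fun p : QuiverPath V => pathCoord K p.path)) := by
    refine Submodule.span_le.2 ?_
    rintro _ ⟨⟨a, b, p⟩, hp, rfl⟩
    rw [SetLike.mem_coe, LinearMap.mem_ker, PathAlgebra.lift_ofPath]
    match p, hp with
    | .nil, hp => simp at hp
    | .cons .nil _, hp => simp at hp
    | .cons (.cons _ _) _, _ => rfl
  exact h hx

variable (K V)

/-- The canonical map from the path algebra to its radical square zero quotient. -/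
noncomputable def toRadSqZero : PathAlgebra K V →ₐ[K] RadSqZeroAlgebra K V :=
  Ideal.Quotient.mkₐ K _

variable {K V}

theorem toRadSqZero_eq_zero_iff {x : PathAlgebra K V} :
    toRadSqZero K V x = 0 ↔ x ∈ (arrowIdeal K V).asIdeal ^ 2 :=
  Ideal.Quotient.eq_zero_iff_mem

theorem toRadSqZero_surjective : Function.Surjective (toRadSqZero K V) :=
  Ideal.Quotient.mk_surjective

variable (K V)

theorem linearIndependent_shortPath :
    LinearIndependent K fun k => toRadSqZero K V (shortPath K V k) := by
  rw [linearIndependent_iff]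
  intro l hl
  have h1 : toRadSqZero K V (Finsupp.linearCombination K (shortPath K V) l) = 0 := by
    rw [← hl, ← AlgHom.toLinearMap_apply, Finsupp.apply_linearCombination]
    rfl
  have h2 := lift_pathCoord_eq_zero
    (mem_pathFiltration_two_of_mem_sq (toRadSqZero_eq_zero_iff.1 h1))
  rw [Finsupp.apply_linearCombination, Finsupp.linearCombination_apply] at h2
  simpa [lift_pathCoord_shortPath] using h2

theorem top_le_span_shortPath :
    ⊤ ≤ Submodule.span K (Set.range fun k => toRadSqZero K V (shortPath K V k)) := by
  intro y _
  obtain ⟨x, rfl⟩ := toRadSqZero_surjective y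
  refine span_ofPath_induction (q := (Submodule.span K
    (Set.range fun k => toRadSqZero K V (shortPath K V k))).comap (toRadSqZero K V).toLinearMap)
    (fun p => ?_) x
  obtain ⟨a, b, p⟩ := p
  rw [Submodule.mem_comap, AlgHom.toLinearMap_apply]
  match p with
  | .nil => exact Submodule.subset_span ⟨.inl a, rfl⟩
  | .cons .nil e => exact Submodule.subset_span ⟨.inr ⟨a, b, e⟩, rfl⟩
  | .cons (.cons p e) f =>
    rw [toRadSqZero_eq_zero_iff.2 (ofPath_cons_cons_mem_sq p e f)]
    exact zero_mem _

/-- The basis of the radical square zero algebra of a quiver by vertices and arrows. -/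
noncomputable def radSqZeroBasis : RadSqZeroBasis K (RadSqZeroAlgebra K V)
    -- Paths compose from left to right, so the idempotent fixing an arrow on the left is the one at
    -- its source; `s` is the target map and `t` the source map.
    (fun i : QuiverArrow V => i.2.1) (fun i => i.1) where
  basis := Module.Basis.mk (linearIndependent_shortPath K V) (top_le_span_shortPath K V)
  vertex_mul_self v := by
    simp only [Module.Basis.mk_apply, ← map_mul, shortPath]
    rw [ofPath_mul_ofPath, Quiver.Path.comp_nil]
  vertex_mul_vertex {v w} h := by
    simp only [Module.Basis.mk_apply, ← map_mul, shortPath]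
    rw [ofPath_mul_ofPath_of_ne h, map_zero]
  vertex_mul_arrow i := by
    simp only [Module.Basis.mk_apply, ← map_mul, shortPath]
    rw [ofPath_mul_ofPath, Quiver.Path.nil_comp]
  vertex_mul_arrow_of_ne {v i} h := by
    simp only [Module.Basis.mk_apply, ← map_mul, shortPath]
    rw [ofPath_mul_ofPath_of_ne h, map_zero]
  arrow_mul_vertex i := by
    simp only [Module.Basis.mk_apply, ← map_mul, shortPath]
    rw [ofPath_mul_ofPath, Quiver.Path.comp_nil]
  arrow_mul_vertex_of_ne {v i} h := by
    simp only [Module.Basis.mk_apply, ← map_mul, shortPath]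
    rw [ofPath_mul_ofPath_of_ne (Ne.symm h), map_zero]
  arrow_mul_arrow i j := by
    simp only [Module.Basis.mk_apply, ← map_mul, shortPath]
    rw [toRadSqZero_eq_zero_iff, arrowIdeal_sq]
    exact Ideal.mul_mem_mul
      (TwoSidedIdeal.mem_asIdeal.2 (TwoSidedIdeal.subset_span ⟨_, _, i.2.2, rfl⟩))
      (TwoSidedIdeal.mem_asIdeal.2 (TwoSidedIdeal.subset_span ⟨_, _, j.2.2, rfl⟩))

end PathAlgebra

end IgusaTodorov

theorem theorem4p13 (K : Type v) [Field K] (V : Type w) [Fintype V] [Quiver.{x} V]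
    [∀ a b : V, Finite (a ⟶ b)] (hV : IgusaTodorov.QuiverConnected V)
    (A : Type u) [Ring A] [Algebra K A] [Module.Finite K A]
    (hA : Nonempty (A ≃ₐ[K] IgusaTodorov.RadSqZeroAlgebra K V)) :
    IgusaTodorov.phiDim K A = IgusaTodorov.phiDim K Aᵐᵒᵖ := by
  obtain ⟨f⟩ := hA
  let D := (IgusaTodorov.radSqZeroBasis K V).mapEquiv f.symm
  have : IsArtinianRing Aᵐᵒᵖ := IsArtinianRing.of_finite K Aᵐᵒᵖ
  have : IsArtinianRing Aᵐᵒᵖᵐᵒᵖ := IsArtinianRing.of_finite K Aᵐᵒᵖᵐᵒᵖ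
  -- Right modules over `A` and over `Aᵐᵒᵖ` are left modules over `Aᵐᵒᵖ` and `Aᵐᵒᵖᵐᵒᵖ`, whose bases
  -- differ by reversing the arrows.
  exact D.op.leftModulePhiDim_eq_of_swap D.op.op
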